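/- **Setting.** Let $\sigma$ be a finite relational signature, let $[n]=\{1,\dots,n\}$ and let $\mathbf W_n$ be the set of all $\sigma$-structures with domain $[n]$. Let $[0,1]^{<\omega}=\bigcup_{n\ge 1}[0,1]^n$. *Aggregation functions.* For $k\ge 1$, an *aggregation function* is a function $F:([0,1]^{<\omega})^k\to[0,1]$ whose value does not change when the entries of any of its $k$ arguments are reordered. A sequence $\bar r_n\in[0,1]^{<\omega}$ ($n\in\mathbb N$) is *convergence testing* for $c_1,\dots,c_m\in[0,1]$ and $\alpha_1,\dots,\alpha_m\in[0,1]$ if $|\bar r_n|<|\bar r_{n+1}|$ for all $n$ and, for all pairwise disjoint intervals $I_1,\dots,I_m\subseteq[0,1]$, open in $[0,1]$, with $c_j\in I_j$: for all large $n$ all entries of $\bar r_n$ lie in $\bigcup_j I_j$, and for every $j$ the proportion of the entries of $\bar r_n$ that lie in $I_j$ tends to $\alpha_j$ as $n\to\infty$. $F$ is *admissible* if (1) $F$ is continuous on $[0,1]^{n_1}\times\dots\times[0,1]^{n_k}$ for all $n_1,\dots,n_k\ge1$, and (2) for all $m_1,\dots,m_k\ge 1$, all $c_{i,j}\in[0,1]$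 and $\alpha_{i,j}\in(0,1]$ ($1\le i\le k$, $1\le j\le m_i$), where for each $i$ the numbers $c_{i,1},\dots,c_{i,m_i}$ are distinct, and all $(\bar r_{1,n},\dots,\bar r_{k,n})$, $(\bar\rho_{1,n},\dots,\bar\rho_{k,n})$ ($n\in\mathbb N$) such that, for each $i$, both $(\bar r_{i,n})_n$ and $(\bar\rho_{i,n})_n$ are convergence testing for $c_{i,1},\dots,c_{i,m_i}$ and $\alpha_{i,1},\dots,\alpha_{i,m_i}$, one has $|F(\bar r_{1,n},\dots,\bar r_{k,n})-F(\bar\rho_{1,n},\dots,\bar\rho_{k,n})|\to0$. *Formulas.* $PLA(\sigma)$ is the least set of formulas that contains each constant $c\in[0,1]$ (with $\top=1$), $x=y$, and $R(x_1,\dots,x_r)$ ($R\in\sigma$ of arity $r$), and is closed under $\neg\varphi$, $\varphi\wedge\psi$, $\varphi\vee\psi$, $\varphi\to\psi$, $\varphi\psi+(1-\varphi)\chi$ and aggregation $$F(\varphi_1(\bar x,\bar y),\dots,\varphi_k(\bar x,\bar y):\bar y:p^=(\bar x,\bar y)),$$ where $F$ is an aggregation function of $k\ge1$ arguments, $\bar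 x\bar y$ is a tuple of distinct variables which contains all free variables of the $\varphi_i$, and $p^=(\bar x,\bar y)$ is a complete consistent description of the equalities and inequalities between the variables of $\bar x\bar y$. Aggregation binds $\bar y$; its free variables are those of $\bar x$. Writing $\varphi(\bar x)$ means that $\bar x$ is a tuple of distinct variables that contains all free variables of $\varphi$. For a finite $\sigma$-structure $\mathcal A$ with domain $A$ and $\bar a\in A^{|\bar x|}$, the value $\mathcal A(\varphi(\bar a))\in[0,1]$ is $c$ for the constant $c$; it is $1$ or $0$ for an atomic formula $x=y$ or $R(\ldots)$ according to whether it holds or not; the connectives $\neg,\wedge,\vee,\to$ have the truth functions $1-a$, $\min(a,b)$, $\max(a,b)$, $\min(1,1-a+b)$, and $\varphi\psi+(1-\varphi)\chi$ is computed as written. The value of the aggregation displayed above at $\bar a$ is $F(\bar r_1,\dots,\bar r_k)$, where $\bar r_i$ lists the values $\mathcal A(\varphi_i(\bar a,\bar b))$ for all $\bar b\in A^{|\bar y|}$ such that $p^=(\bar a,\bar b)$ holds; if there is no such $\bar b$, the value is $0$ by convention. A formula is *aggregation-function-free* if it contains no aggregation. A *basic probability formula* is a formula $\bigwedge_{i=1}^{s}(\psi_i\to\alpha_i)$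 with $s\ge1$, $\alpha_i\in[0,1]$ and each $\psi_i$ a conjunction (possibly the empty conjunction $\top$) of first-order literals, i.e. of formulas $x=y$, $R(x_1,\dots,x_r)$ and their negations. *Networks.* A $PLA(\sigma)$-network $\mathbb G$ consists of a directed acyclic graph with vertex set $\sigma$ and, for each $R\in\sigma$, of arity $k_R$, an *aggregation formula* $\theta_R(\bar x)$ with $|\bar x|=k_R$, in which only relation symbols that are parents of $R$ occur. It induces for each $n$ the probability distribution on $\mathbf W_n$ given by $$\mathbb P_n(\mathcal A)=\prod_{R\in\sigma}\ \prod_{\bar a\in R^{\mathcal A}}\mathcal A(\theta_R(\bar a))\prod_{\bar a\in[n]^{k_R}\setminus R^{\mathcal A}}\bigl(1-\mathcal A(\theta_R(\bar a))\bigr).$$ **Theorem.** Let $\sigma$ be a finite relational signature and let $\mathbb G$ be a $PLA(\sigma)$-network all of whose aggregation formulas $\theta_R$ are aggregation-function-free. Let $\varphi(\bar x)\in PLA(\sigma)$ be such that all aggregation functions in $\varphi$ are admissible. Then there is a basic probability formula $\psi(\bar x)$ over $\sigma$ that is asymptotically equivalent to $\varphi(\bar x)$ with respect to $\mathbb G$: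 for every $\varepsilon>0$, $$\mathbb P_n\bigl(\{\mathcal A\in\mathbf W_n:\text{ there is }\bar a\in[n]^{|\bar x|}\text{ with }|\mathcal A(\varphi(\bar a))-\mathcal A(\psi(\bar a))|>\varepsilon\}\bigr)\to0\quad\text{as }n\to\infty.$$ -/

import Mathlib

open Filter Topology

universe u v

noncomputable section

/-! ### Finite sequences in the unit interval and aggregation functions -/

/-- The set of all nonempty finite sequences (of length `n ≥ 1`) of elements of `[0, 1]`. -/
abbrev UnitSeq : Type := Σ n : ℕ+, (Fin n → unitInterval)

/-- An aggregation function of `k` arguments: a function of `k` nonempty finite sequences in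
`[0, 1]` (not necessarily of the same length), with values in `[0, 1]`, which is invariant under
separate reorderings of the entries of its arguments. -/
structure AggFun (k : ℕ) where
  toFun : (Fin k → UnitSeq) → unitInterval
  symmetric : ∀ (n : Fin k → ℕ+) (r : ∀ i, Fin (n i) → unitInterval)
    (π : ∀ i, Equiv.Perm (Fin (n i))),
    toFun (fun i => ⟨n i, r i ∘ π i⟩) = toFun (fun i => ⟨n i, r i⟩)

/-- The sequence (of sequences) `r` is convergence testing for the parameters `c` and `α`.
The intervals are open as subsets of the space `[0, 1]`, so that `0` and `1` may be parameters. -/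
def ConvergenceTesting {m : ℕ} (r : ℕ → UnitSeq) (c α : Fin m → unitInterval) : Prop :=
  (∀ n, (r n).1 < (r (n + 1)).1) ∧
  ∀ J : Fin m → Set unitInterval,
    (∀ j, IsOpen (J j) ∧ (J j).OrdConnected ∧ c j ∈ J j) →
    (∀ j j', j ≠ j' → Disjoint (J j) (J j')) →
      (∃ N, ∀ n ≥ N, ∀ i, (r n).2 i ∈ ⋃ j, J j) ∧
      ∀ j, Tendsto (fun n => (Nat.card {i // (r n).2 i ∈ J j} : ℝ) / ((r n).1 : ℕ)) atTop
        (𝓝 (α j : ℝ))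

/-- Admissible aggregation functions. -/
def AggFun.Admissible {k : ℕ} (F : AggFun k) : Prop :=
  (∀ n : Fin k → ℕ+,
    Continuous fun r : (∀ i, Fin (n i) → unitInterval) => F.toFun (fun i => ⟨n i, r i⟩)) ∧
  ∀ (m : Fin k → ℕ) (c α : ∀ i, Fin (m i) → unitInterval) (r ρ : ℕ → Fin k → UnitSeq),
    (∀ i, 0 < m i) → (∀ i, Function.Injective (c i)) → (∀ i j, 0 < α i j) →
    (∀ i, ConvergenceTesting (fun n => r n i) (c i) (α i)) →
    (∀ i, ConvergenceTesting (fun n => ρ n i) (c i) (α i)) →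
    Tendsto (fun n => |(F.toFun (r n) : ℝ) - (F.toFun (ρ n) : ℝ)|) atTop (𝓝 0)

/-! ### Probability logic with aggregation functions: syntax -/

/-- The relation symbols of a signature, each one together with its arity. -/
abbrev RelSymb (L : FirstOrder.Language.{u, v}) : Type v := Σ r : ℕ, L.Relations r

/-- `PLA L m` is the set of the formulas `φ(x₀, …, x_{m-1})` of the probability logic with
aggregation functions over the relational signature `L`, that is, of the formulas given together
with a tuple of `m` distinct variables which contains all their free variables. A variable is
represented by its position in the tuple.

`agg k _ p l F x φ e` is the formula `F(φ₁(x̄, ȳ), …, φ_k(x̄, ȳ) : ȳ : p⁼(x̄, ȳ))` where `x̄` is the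
tuple of the `p` distinct variables `x 0, …, x (p - 1)`, where `ȳ` consists of `l` new variables,
which are bound, and where the complete atomic type `p⁼` over the empty signature is given by the
equivalence relation `e`, on the positions of `x̄ȳ`, of being equal according to `p⁼`. -/
inductive PLA (L : FirstOrder.Language.{u, v}) : ℕ → Type v
  | const {m : ℕ} (c : unitInterval) : PLA L m
  | eq {m : ℕ} (x y : Fin m) : PLA L m
  | rel {m : ℕ} (R : RelSymb L) (x : Fin R.1 → Fin m) : PLA L m
  | neg {m : ℕ} (φ : PLA L m) : PLA L m
  | conj {m : ℕ} (φ ψ : PLA L m) : PLA L m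
  | disj {m : ℕ} (φ ψ : PLA L m) : PLA L m
  | imp {m : ℕ} (φ ψ : PLA L m) : PLA L m
  | wmean {m : ℕ} (φ ψ χ : PLA L m) : PLA L m
  | agg {m : ℕ} (k : ℕ) (hk : 0 < k) (p l : ℕ) (F : AggFun k) (x : Fin p ↪ Fin m)
      (φ : Fin k → PLA L (p + l)) (e : Setoid (Fin (p + l))) : PLA L m

namespace PLA

variable {L : FirstOrder.Language.{u, v}}

/-- The set of the relation symbols that occur in a formula. -/
def symbols : {m : ℕ} → PLA L m → Set (RelSymb L)
  | _, const _ => ∅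
  | _, eq _ _ => ∅
  | _, rel R _ => {R}
  | _, neg φ => φ.symbols
  | _, conj φ ψ => φ.symbols ∪ ψ.symbols
  | _, disj φ ψ => φ.symbols ∪ ψ.symbols
  | _, imp φ ψ => φ.symbols ∪ ψ.symbols
  | _, wmean φ ψ χ => φ.symbols ∪ ψ.symbols ∪ χ.symbols
  | _, agg _ _ _ _ _ _ φ _ => ⋃ i, (φ i).symbols

/-- The formula contains no aggregation function. -/
def AggFree : {m : ℕ} → PLA L m → Prop
  | _, const _ => True
  | _, eq _ _ => True
  | _, rel _ _ => True
  | _, neg φ => φ.AggFree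
  | _, conj φ ψ => φ.AggFree ∧ ψ.AggFree
  | _, disj φ ψ => φ.AggFree ∧ ψ.AggFree
  | _, imp φ ψ => φ.AggFree ∧ ψ.AggFree
  | _, wmean φ ψ χ => φ.AggFree ∧ ψ.AggFree ∧ χ.AggFree
  | _, agg _ _ _ _ _ _ _ _ => False

/-- All aggregation functions that occur in the formula are admissible. -/
def AllAdmissible : {m : ℕ} → PLA L m → Prop
  | _, const _ => True
  | _, eq _ _ => True
  | _, rel _ _ => True
  | _, neg φ => φ.AllAdmissible
  | _, conj φ ψ => φ.AllAdmissible ∧ ψ.AllAdmissible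
  | _, disj φ ψ => φ.AllAdmissible ∧ ψ.AllAdmissible
  | _, imp φ ψ => φ.AllAdmissible ∧ ψ.AllAdmissible
  | _, wmean φ ψ χ => φ.AllAdmissible ∧ ψ.AllAdmissible ∧ χ.AllAdmissible
  | _, agg _ _ _ _ F _ φ _ => F.Admissible ∧ ∀ i, (φ i).AllAdmissible

/-- First-order atomic formulas. -/
def IsAtomic {m : ℕ} (φ : PLA L m) : Prop :=
  (∃ x y, φ = eq x y) ∨ ∃ R x, φ = rel R x

/-- First-order literals. -/
def IsLiteral {m : ℕ} (φ : PLA L m) : Prop :=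
  φ.IsAtomic ∨ ∃ ψ : PLA L m, ψ.IsAtomic ∧ φ = neg ψ

/-- The conjunction of a list of formulas; the empty conjunction is `⊤`, that is, the constant `1`. -/
def listConj {m : ℕ} : List (PLA L m) → PLA L m
  | [] => const 1
  | [φ] => φ
  | φ :: χ :: l => conj φ (listConj (χ :: l))

/-- Basic probability formulas: conjunctions of one or more formulas `ψᵢ → αᵢ`, where `ψᵢ` is a
conjunction of first-order literals and `αᵢ ∈ [0, 1]`. -/
def IsBasicProbability {m : ℕ} (φ : PLA L m) : Prop :=
  ∃ l : List (List (PLA L m) × unitInterval), l ≠ [] ∧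
    (∀ q ∈ l, ∀ χ ∈ q.1, χ.IsLiteral) ∧
    φ = listConj (l.map fun q => imp (listConj q.1) (const q.2))

end PLA

/-! ### Semantics -/

/-- The truth function of `→`, with value `min (1, 1 - a + b)`. -/
def unitImp (a b : unitInterval) : unitInterval :=
  ⟨min 1 (1 - a + b), le_min zero_le_one (by linarith [a.2.2, b.2.1]), min_le_left _ _⟩

/-- The truth function of the weighted mean, with value `a b + (1 - a) c`. -/
def unitMean (a b c : unitInterval) : unitInterval :=
  ⟨a * b + (1 - a) * c, by
    have h₁ := mul_nonneg a.2.1 b.2.1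
    have h₂ := mul_nonneg (sub_nonneg.2 a.2.2) c.2.1
    have h₃ := mul_le_mul_of_nonneg_left b.2.2 a.2.1
    have h₄ := mul_le_mul_of_nonneg_left c.2.2 (sub_nonneg.2 a.2.2)
    constructor <;> linarith⟩

/-- The tuples `b̄` for which the type `p⁼(ā, b̄)`, given by the equivalence relation `e`, holds. -/
abbrev Realizations {D : Type*} {p l : ℕ} (a : Fin p → D) (e : Setoid (Fin (p + l))) : Type _ :=
  {b : Fin l → D // ∀ i j, e.r i j ↔ Fin.append a b i = Fin.append a b j}

open Classical in
/-- The value `𝒜(φ(ā))` of a formula in a finite structure. For an aggregation the sequences are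
enumerated in an arbitrary order, which does not matter since `F` is symmetric; if there is no
tuple `b̄` for which `p⁼(ā, b̄)` holds, the value is `0` by convention. -/
def PLA.value {L : FirstOrder.Language.{u, v}} {D : Type*} [Finite D] (A : L.Structure D) :
    {m : ℕ} → PLA L m → (Fin m → D) → unitInterval
  | _, .const c, _ => c
  | _, .eq x y, a => if a x = a y then 1 else 0
  | _, .rel R x, a => if A.RelMap R.2 (fun i => a (x i)) then 1 else 0
  | _, .neg φ, a => unitInterval.symm (φ.value A a)
  | _, .conj φ ψ, a => min (φ.value A a) (ψ.value A a)
  | _, .disj φ ψ, a => max (φ.value A a) (ψ.value A a)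
  | _, .imp φ ψ, a => unitImp (φ.value A a) (ψ.value A a)
  | _, .wmean φ ψ χ, a => unitMean (φ.value A a) (ψ.value A a) (χ.value A a)
  | _, .agg _ _ _ _ F x φ e, a =>
      if h : 0 < Nat.card (Realizations (a ∘ x) e) then
        F.toFun fun i => ⟨⟨Nat.card (Realizations (a ∘ x) e), h⟩, fun j =>
          (φ i).value A
            (Fin.append (a ∘ x) ((Finite.equivFin (Realizations (a ∘ x) e)).symm j).1)⟩
      else 0

/-! ### Networks and the induced probability distributions -/

/-- A network over the signature `L`: a directed acyclic graph whose vertices are the relation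
symbols (where `edge R' R` means that `R'` is a parent of `R`) and, for each relation symbol `R`, a
formula `θ_R(x̄)` over the signature `par(R)`, where the length of `x̄` is the arity of `R`. -/
structure PLANetwork (L : FirstOrder.Language.{u, v}) where
  edge : RelSymb L → RelSymb L → Prop
  acyclic : ∀ R, ¬ Relation.TransGen edge R R
  θ : ∀ R : RelSymb L, PLA L R.1
  symbols_θ : ∀ R, ∀ R' ∈ (θ R).symbols, edge R' R

/-- A structure for a relational signature is given by the interpretations of the symbols. -/
def structureEquiv (L : FirstOrder.Language.{u, v}) [L.IsRelational] (D : Type*) :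
    L.Structure D ≃ (∀ R : RelSymb L, (Fin R.1 → D) → Prop) where
  toFun A R a := A.RelMap R.2 a
  invFun I := { funMap := fun f => isEmptyElim f, RelMap := fun {r} R a => I ⟨r, R⟩ a }
  left_inv A := by
    refine FirstOrder.Language.Structure.ext ?_ rfl
    funext n f
    exact isEmptyElim f
  right_inv _ := rfl

/-- There are finitely many structures with a given finite domain for a finite relational
signature. -/
instance fintypeStructure (L : FirstOrder.Language.{u, v}) [L.IsRelational] [Fintype (RelSymb L)] (n : ℕ) :
    Fintype (L.Structure (Fin n)) := by
  classical exact Fintype.ofEquiv _ (structureEquiv L (Fin n)).symm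

namespace PLANetwork

variable {L : FirstOrder.Language.{u, v}} [Fintype (RelSymb L)]

open Classical in
/-- The probability `ℙ_n(𝒜)` of a structure `𝒜` with domain `Fin n`: given the interpretations of
the parents of `R`, each tuple `ā` belongs to `R` with probability the value of `θ_R(ā)`,
independently of the other tuples and of the other symbols of the same rank. -/
def probStructure (G : PLANetwork L) (n : ℕ) (A : L.Structure (Fin n)) : ℝ :=
  ∏ R : RelSymb L, ∏ a : Fin R.1 → Fin n,
    if A.RelMap R.2 a then ((G.θ R).value A a : ℝ) else 1 - ((G.θ R).value A a : ℝ)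

/-- The probability `ℙ_n(E)` of a set `E` of structures with domain `Fin n`. -/
def prob [L.IsRelational] (G : PLANetwork L) (n : ℕ) (E : Set (L.Structure (Fin n))) : ℝ :=
  ∑ A, E.indicator (G.probStructure n) A

/-- Asymptotic equivalence of formulas with respect to the distributions induced by the network. -/
def AsympEquiv [L.IsRelational] (G : PLANetwork L) {m : ℕ} (φ ψ : PLA L m) : Prop :=
  ∀ ε : ℝ, 0 < ε →
    Tendsto (fun n : ℕ => G.prob n {A | ∃ a : Fin m → Fin n,
      ε < |(φ.value A a : ℝ) - (ψ.value A a : ℝ)|}) atTop (𝓝 0)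

end PLANetwork

end

/-! Without aggregations, `θ_R(ā)` depends only on the atomic type of `ā`. Fix a tuple `ā` and
condition on the atoms over its entries. The atoms over `āb` that mention `b` form disjoint blocks
for different fresh elements `b`, and these blocks are conditionally independent. Hence the
indicators of "`āb` has type `q`" are conditionally independent, with a success probability
`freshWeight q` that depends only on `q` as soon as `ā` has the type that `q` prescribes
(`sum_fresh_centered`). An exponential moment bound gives deviations of probability `2 exp (-δ² n /
4)`, which survives the union bound over all `n ^ K` tuples. With probability tending to `1`, every
tuple therefore has about `n * freshWeight q` fresh extensions of each compatible type `q`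
(`PLANetwork.whp_fresh_saturated`).

Adding bound variables one at a time multiplies these weights (`exists_append_weight`): the
proportions of the types of `āb̄` among the tuples `b̄` that an aggregation ranges over converge,
uniformly in `ā`, to numbers determined by the type of `ā`. If the formulas inside the aggregation
are nearly functions of the atomic type, the listed sequences are thus close to samples from
finitely many values with fixed frequencies, and admissibility with compactness gives a limit of `F`
(`AggFun.Admissible.exists_limit`). When `p⁼` admits no new element, the sequences have length `1`
and continuity takes over (`AggFun.Admissible.exists_limit_one`).

Induction on the formula then yields a function of the atomic type that approximates its value
(`PLA.exists_atomicType_value`). There are finitely many types, so this function is the value of a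
basic probability formula (`exists_isBasicProbability_value`). -/

noncomputable section

/-! ### Concentration for coins tossed in a dependency order -/

section BiasedCoins

open scoped Classical

/-- The probability that a coin with bias `g` shows `P`. -/
def bias (g : ℝ) (P : Prop) : ℝ := if P then g else 1 - g

theorem bias_nonneg {g : ℝ} (h₀ : 0 ≤ g) (h₁ : g ≤ 1) (P : Prop) : 0 ≤ bias g P := by
  unfold bias; split_ifs <;> linarith

theorem bias_le_one {g : ℝ} (h₀ : 0 ≤ g) (h₁ : g ≤ 1) (P : Prop) : bias g P ≤ 1 := by
  unfold bias; split_ifs <;> linarith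

variable {V : Type*}

theorem dependsOn_bias {g : (V → Prop) → ℝ} {s : Set V} {v : V} (hg : DependsOn g s)
    (hv : v ∈ s) : DependsOn (fun ω : V → Prop => 2 * bias (g ω) (ω v)) s :=
  fun ω ω' h => by simp only [hg h, h v hv]

theorem dependsOn_mul {s : Set V} {f g : (V → Prop) → ℝ} (hf : DependsOn f s)
    (hg : DependsOn g s) : DependsOn (fun ω => f ω * g ω) s :=
  fun ω ω' h => by simp only [hf h, hg h]

theorem dependsOn_prod {ι : Type*} {s : Set V} {B : Finset ι} {f : ι → (V → Prop) → ℝ}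
    (hf : ∀ b ∈ B, DependsOn (f b) s) : DependsOn (fun ω => ∏ b ∈ B, f b ω) s :=
  fun _ _ h => Finset.prod_congr rfl fun b hb => hf b hb h

theorem DependsOn.subset {α : Type*} {s t : Set V} {f : (V → Prop) → α} (hf : DependsOn f s)
    (h : s ⊆ t) : DependsOn f t := fun _ _ hx => hf fun i hi => hx i (h hi)

variable [Fintype V] [DecidableEq V]

/-- Flipping the coordinate `u` exchanges `bias` with its complement, so the two weights of each
flipped pair add up to `2`. The factor `2` makes `2 * bias` a density with respect to a fair coin,
so that sums over all configurations can be used without normalization. -/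
theorem sum_mul_two_bias (u : V) (g k : (V → Prop) → ℝ) (hg : DependsOn g {u}ᶜ)
    (hk : DependsOn k {u}ᶜ) :
    ∑ ω, k ω * (2 * bias (g ω) (ω u)) = ∑ ω, k ω := by
  let τ : (V → Prop) → (V → Prop) := fun ω => Function.update ω u (¬ ω u)
  have hτ : Function.Involutive τ := fun ω => by
    funext x
    by_cases hx : x = u
    · subst hx; simp [τ]
    · simp [τ, hx]
  have hdep : ∀ {m : (V → Prop) → ℝ}, DependsOn m {u}ᶜ → ∀ ω, m (τ ω) = m ω := fun hm ω =>
    hm fun x hx => by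
      have : x ≠ u := hx
      simp [τ, this]
  have h1 : ∑ ω, k ω * bias (g ω) (ω u) = ∑ ω, k ω * (1 - bias (g ω) (ω u)) := by
    refine Fintype.sum_equiv hτ.toPerm _ _ fun ω => ?_
    rw [Function.Involutive.coe_toPerm, hdep hk, hdep hg]
    by_cases h : ω u <;> simp [τ, bias, h]
  have h2 : ∑ ω, k ω * (2 * bias (g ω) (ω u)) =
      ∑ ω, k ω * bias (g ω) (ω u) + ∑ ω, k ω * bias (g ω) (ω u) := by
    rw [← Finset.sum_add_distrib]; exact Finset.sum_congr rfl fun _ _ => by ring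
  rw [h2]
  nth_rewrite 1 [h1]
  rw [← Finset.sum_add_distrib]
  exact Finset.sum_congr rfl fun _ _ => by ring

variable {r : V → V → Prop} {g : V → (V → Prop) → ℝ}

/-- Coordinates which are sampled after all others can be integrated out. -/
theorem sum_mul_prod_two_bias (hr : WellFounded fun u v => r v u) (W : Finset V)
    (hg : ∀ v ∈ W, DependsOn (g v) {u | r u v}) (h : (V → Prop) → ℝ)
    (hh : DependsOn h (W : Set V)ᶜ) :
    ∑ ω, h ω * ∏ v ∈ W, (2 * bias (g v ω) (ω v)) = ∑ ω, h ω := by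
  induction W using Finset.strongInduction with
  | H W ih =>
    rcases W.eq_empty_or_nonempty with rfl | hW
    · simp
    -- The order is reversed, so a minimal `u` is one that no bias in `W` depends on: it can be
    -- summed out first.
    obtain ⟨u, hu, hmax⟩ := hr.has_min (W : Set V) hW
    have hu' : u ∈ W := hu
    have hne : ∀ v ∈ W, DependsOn (g v) {u}ᶜ := fun v hv =>
      (hg v hv).subset fun x hx hxu => hmax v hv (by rw [← Set.mem_singleton_iff.1 hxu]; exact hx)
    have hsplit : ∀ ω : V → Prop, h ω * ∏ v ∈ W, (2 * bias (g v ω) (ω v)) =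
        (h ω * ∏ v ∈ W.erase u, (2 * bias (g v ω) (ω v))) * (2 * bias (g u ω) (ω u)) := fun ω => by
      rw [← Finset.mul_prod_erase W _ hu']; ring
    simp_rw [hsplit]
    rw [sum_mul_two_bias u (g u) _ (hne u hu')]
    · refine ih (W.erase u) (Finset.erase_ssubset hu')
        (fun v hv => hg v (Finset.mem_of_mem_erase hv)) (hh.subset ?_)
      simp
    · refine dependsOn_mul (hh.subset ?_) (dependsOn_prod fun v hv => dependsOn_bias
        (hne v (Finset.mem_of_mem_erase hv)) (Finset.ne_of_mem_erase hv))
      simpa using hu'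

/-- The exponential moments of a sum of variables which are conditionally independent and
conditionally centered given the coordinates in `C₀`. -/
theorem sum_prod_bias_mul_exp_le {ι : Type*} (hr : WellFounded fun u v => r v u)
    (hg : ∀ v, DependsOn (g v) {u | r u v}) (h₀ : ∀ v ω, 0 ≤ g v ω) (h₁ : ∀ v ω, g v ω ≤ 1)
    (B : Finset ι) (C₀ : Finset V) (C : ι → Finset V)
    (hC₀ : ∀ b ∈ B, Disjoint C₀ (C b))
    (hC : ∀ b ∈ B, ∀ b' ∈ B, b ≠ b' → Disjoint (C b) (C b'))
    (hg₀ : ∀ v ∈ C₀, DependsOn (g v) (C₀ : Set V))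
    (hgC : ∀ b ∈ B, ∀ v ∈ C b, DependsOn (g v) (C₀ ∪ C b : Set V))
    (Y : ι → (V → Prop) → ℝ) (hY : ∀ b ∈ B, DependsOn (Y b) (C₀ ∪ C b : Set V))
    (hY₁ : ∀ b ∈ B, ∀ ω, |Y b ω| ≤ 1)
    (hcent : ∀ b ∈ B, ∀ h : (V → Prop) → ℝ, DependsOn h (C b : Set V)ᶜ →
      ∑ ω, h ω * (∏ v ∈ C b, (2 * bias (g v ω) (ω v))) * Y b ω = 0)
    {t : ℝ} (ht₀ : 0 ≤ t) (ht₁ : t ≤ 1) :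
    ∑ ω : V → Prop, (∏ v, bias (g v ω) (ω v)) * Real.exp (t * ∑ b ∈ B, Y b ω) ≤
      (1 + t ^ 2) ^ B.card := by
  set ρ : Finset V → (V → Prop) → ℝ := fun W ω => ∏ v ∈ W, (2 * bias (g v ω) (ω v)) with hρ
  have hρ0 : ∀ W ω, 0 ≤ ρ W ω := fun W ω => Finset.prod_nonneg fun v _ =>
    mul_nonneg zero_le_two (bias_nonneg (h₀ v ω) (h₁ v ω) _)
  set H : Finset ι → (V → Prop) → ℝ := fun B ω =>
    ρ C₀ ω * ∏ b ∈ B, (ρ (C b) ω * Real.exp (t * Y b ω)) with hH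
  have hH0 : ∀ B ω, 0 ≤ H B ω := fun B ω => mul_nonneg (hρ0 _ _)
    (Finset.prod_nonneg fun b _ => mul_nonneg (hρ0 _ _) (Real.exp_pos _).le)
  have hHdep : ∀ B' ⊆ B, DependsOn (H B') ((C₀ : Set V) ∪ ⋃ b ∈ B', (C b : Set V)) := by
    intro B' hB'
    refine dependsOn_mul (dependsOn_prod fun v hv => dependsOn_bias ((hg₀ v hv).subset
      Set.subset_union_left) (Or.inl hv)) (dependsOn_prod fun b hb => ?_)
    have hsub : (C₀ ∪ C b : Set V) ⊆ (C₀ : Set V) ∪ ⋃ b ∈ B', (C b : Set V) :=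
      Set.union_subset_union_right _ (Set.subset_biUnion_of_mem (u := fun b => (C b : Set V)) hb)
    refine dependsOn_mul (dependsOn_prod fun v hv => dependsOn_bias ((hgC b (hB' hb) v hv).subset
      hsub) (hsub (Or.inr hv))) ?_
    intro ω ω' h
    simp only [hY b (hB' hb) fun i hi => h i (hsub hi)]
  have hmain : ∀ B' ⊆ B, ∑ ω, H B' ω ≤ (1 + t ^ 2) ^ B'.card * 2 ^ Fintype.card V := by
    intro B' hB'
    induction B' using Finset.induction_on with
    | empty =>
      have := sum_mul_prod_two_bias hr C₀ (fun v _ => hg v) (fun _ => 1) (fun _ _ _ => rfl)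
      simp only [one_mul] at this
      simp only [hH, Finset.prod_empty, mul_one, hρ, this]
      simp
    | insert b B' hb ih =>
      have hbB : b ∈ B := hB' (Finset.mem_insert_self _ _)
      have hB'B : B' ⊆ B := (Finset.subset_insert _ _).trans hB'
      have hdep : DependsOn (H B') (C b : Set V)ᶜ := by
        refine (hHdep B' hB'B).subset ?_
        rintro x hx hxb
        rcases hx with hx | hx
        · exact Finset.disjoint_left.1 (hC₀ b hbB) hx hxb
        · simp only [Set.mem_iUnion] at hx
          obtain ⟨b', hb', hx⟩ := hx
          exact Finset.disjoint_left.1 (hC b' (hB'B hb') b hbB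
            (fun h => hb (h ▸ hb'))) hx hxb
      have hI := sum_mul_prod_two_bias hr (C b) (fun v _ => hg v) (H B') hdep
      have hcc := hcent b hbB (H B') hdep
      calc ∑ ω, H (insert b B') ω
          = ∑ ω, H B' ω * ρ (C b) ω * Real.exp (t * Y b ω) := by
            refine Finset.sum_congr rfl fun ω _ => ?_
            simp only [hH, Finset.prod_insert hb]; ring
        -- `exp x ≤ 1 + x + x²` for `|x| ≤ 1`. The linear term vanishes by `hcent`, so each block
        -- costs only a factor `1 + t²`.
        _ ≤ ∑ ω, H B' ω * ρ (C b) ω * (1 + t ^ 2 + t * Y b ω) := by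
            refine Finset.sum_le_sum fun ω _ => mul_le_mul_of_nonneg_left ?_
              (mul_nonneg (hH0 _ _) (hρ0 _ _))
            have hy := hY₁ b hbB ω
            have hty : |t * Y b ω| ≤ t := by
              rw [abs_mul, abs_of_nonneg ht₀]; exact mul_le_of_le_one_right ht₀ hy
            have h3 := Real.abs_exp_sub_one_sub_id_le (hty.trans ht₁)
            have h4 : (t * Y b ω) ^ 2 ≤ t ^ 2 := by
              rw [← sq_abs]; exact pow_le_pow_left₀ (abs_nonneg _) hty 2
            linarith [(abs_le.1 h3).2]
        _ = (1 + t ^ 2) * ∑ ω, H B' ω * ρ (C b) ω +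
              t * ∑ ω, H B' ω * ρ (C b) ω * Y b ω := by
            rw [Finset.mul_sum, Finset.mul_sum, ← Finset.sum_add_distrib]
            exact Finset.sum_congr rfl fun _ _ => by ring
        _ = (1 + t ^ 2) * ∑ ω, H B' ω := by rw [hI, hcc]; ring
        _ ≤ (1 + t ^ 2) * ((1 + t ^ 2) ^ B'.card * 2 ^ Fintype.card V) := by
            have := ih hB'B
            gcongr
        _ = _ := by rw [Finset.card_insert_of_notMem hb, pow_succ]; ring
  -- The biases in `U` read only coordinates in `U`, so the remaining coordinates integrate to `1`
  -- even if some of them precede elements of `U`.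
  set U : Finset V := C₀ ∪ B.biUnion C with hU
  have hUρ : ∀ ω, ρ C₀ ω * ∏ b ∈ B, ρ (C b) ω = ρ U ω := fun ω => by
    simp only [hρ, hU]
    rw [Finset.prod_union, Finset.prod_biUnion]
    · exact fun b hb b' hb' h => hC b hb b' hb' h
    · exact (Finset.disjoint_biUnion_right _ _ _).2 hC₀
  have hfull : ∀ ω, 2 ^ Fintype.card V * ((∏ v, bias (g v ω) (ω v)) *
      Real.exp (t * ∑ b ∈ B, Y b ω)) = H B ω * ρ Uᶜ ω := fun ω => by
    have e1 : H B ω = ρ U ω * Real.exp (t * ∑ b ∈ B, Y b ω) := by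
      rw [← hUρ, Finset.mul_sum, Real.exp_sum]
      simp only [hH, Finset.prod_mul_distrib]; ring
    have e2 : ρ U ω * ρ Uᶜ ω = 2 ^ Fintype.card V * ∏ v, bias (g v ω) (ω v) := by
      simp only [hρ]
      rw [Finset.prod_mul_prod_compl, Finset.prod_mul_distrib]
      simp
    rw [e1]
    linear_combination - Real.exp (t * ∑ b ∈ B, Y b ω) * e2
  have hUdep : DependsOn (H B) ((Uᶜ : Finset V) : Set V)ᶜ := by
    rw [Finset.coe_compl, compl_compl]
    refine (hHdep B subset_rfl).subset ?_
    simp [hU]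
  have hlast := sum_mul_prod_two_bias hr Uᶜ (fun v _ => hg v) (H B) hUdep
  have := hmain B subset_rfl
  rw [← hlast, ← Finset.sum_congr rfl fun ω _ => hfull ω, ← Finset.mul_sum, mul_comm] at this
  exact le_of_mul_le_mul_right this (by positivity)

/-- Markov's inequality for the exponential moment with `t = δ / 2`, applied to `Y` and to `-Y`. The
exponent is `-δ² N / 2` from the threshold plus at most `δ² N / 4` from the moment. -/
theorem sum_prod_bias_tail_le {ι : Type*} (hr : WellFounded fun u v => r v u)
    (hg : ∀ v, DependsOn (g v) {u | r u v}) (h₀ : ∀ v ω, 0 ≤ g v ω) (h₁ : ∀ v ω, g v ω ≤ 1)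
    (B : Finset ι) (C₀ : Finset V) (C : ι → Finset V)
    (hC₀ : ∀ b ∈ B, Disjoint C₀ (C b))
    (hC : ∀ b ∈ B, ∀ b' ∈ B, b ≠ b' → Disjoint (C b) (C b'))
    (hg₀ : ∀ v ∈ C₀, DependsOn (g v) (C₀ : Set V))
    (hgC : ∀ b ∈ B, ∀ v ∈ C b, DependsOn (g v) (C₀ ∪ C b : Set V))
    (Y : ι → (V → Prop) → ℝ) (hY : ∀ b ∈ B, DependsOn (Y b) (C₀ ∪ C b : Set V))
    (hY₁ : ∀ b ∈ B, ∀ ω, |Y b ω| ≤ 1)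
    (hcent : ∀ b ∈ B, ∀ h : (V → Prop) → ℝ, DependsOn h (C b : Set V)ᶜ →
      ∑ ω, h ω * (∏ v ∈ C b, (2 * bias (g v ω) (ω v))) * Y b ω = 0)
    {δ N : ℝ} (hδ₀ : 0 ≤ δ) (hδ₁ : δ ≤ 1) (hN : B.card ≤ N) :
    ∑ ω : V → Prop, (if δ * N < |∑ b ∈ B, Y b ω| then ∏ v, bias (g v ω) (ω v) else 0) ≤
      2 * Real.exp (-(δ ^ 2 / 4) * N) := by
  have key : ∀ Z : ι → (V → Prop) → ℝ,
      ∑ ω : V → Prop, (∏ v, bias (g v ω) (ω v)) * Real.exp (δ / 2 * ∑ b ∈ B, Z b ω) ≤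
        (1 + (δ / 2) ^ 2) ^ B.card →
      ∑ ω : V → Prop, (∏ v, bias (g v ω) (ω v)) * Real.exp (δ / 2 * (∑ b ∈ B, Z b ω - δ * N)) ≤
        Real.exp (-(δ ^ 2 / 4) * N) := fun Z hZ => by
    have e : ∀ ω : V → Prop, (∏ v, bias (g v ω) (ω v)) *
        Real.exp (δ / 2 * (∑ b ∈ B, Z b ω - δ * N)) = Real.exp (-(δ ^ 2 / 2) * N) *
          ((∏ v, bias (g v ω) (ω v)) * Real.exp (δ / 2 * ∑ b ∈ B, Z b ω)) := fun ω => by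
      rw [mul_left_comm, ← Real.exp_add]; congr 2; ring
    simp_rw [e]
    rw [← Finset.mul_sum]
    calc _ ≤ Real.exp (-(δ ^ 2 / 2) * N) * (1 + (δ / 2) ^ 2) ^ B.card := by gcongr
      _ ≤ Real.exp (-(δ ^ 2 / 2) * N) * Real.exp ((δ / 2) ^ 2) ^ B.card := by
          gcongr
          linarith [Real.add_one_le_exp ((δ / 2) ^ 2)]
      _ = Real.exp (-(δ ^ 2 / 2) * N + B.card * (δ / 2) ^ 2) := by
          rw [Real.exp_add, Real.exp_nat_mul]
      _ ≤ _ := by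
          refine Real.exp_le_exp.2 ?_
          nlinarith [mul_le_mul_of_nonneg_right hN (sq_nonneg (δ / 2))]
  have hp := key Y (sum_prod_bias_mul_exp_le hr hg h₀ h₁ B C₀ C hC₀ hC hg₀ hgC Y hY hY₁ hcent
    (by linarith) (by linarith))
  have hn := key (fun b ω => - Y b ω) (sum_prod_bias_mul_exp_le hr hg h₀ h₁ B C₀ C hC₀ hC hg₀ hgC
    (fun b ω => - Y b ω) (fun b hb ω ω' h => by simp only [hY b hb h])
    (fun b hb ω => by rw [abs_neg]; exact hY₁ b hb ω)
    (fun b hb h hh => by simpa using hcent b hb h hh) (by linarith) (by linarith))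
  refine le_trans ?_ ((add_le_add hp hn).trans_eq (two_mul _).symm)
  rw [← Finset.sum_add_distrib]
  refine Finset.sum_le_sum fun ω _ => ?_
  have hf : 0 ≤ ∏ v, bias (g v ω) (ω v) :=
    Finset.prod_nonneg fun v _ => bias_nonneg (h₀ v ω) (h₁ v ω) _
  have e1 := mul_nonneg hf (Real.exp_pos (δ / 2 * (∑ b ∈ B, Y b ω - δ * N))).le
  have e2 := mul_nonneg hf (Real.exp_pos (δ / 2 * (∑ b ∈ B, -Y b ω - δ * N))).le
  split_ifs with h
  · rcases lt_abs.1 h with h | h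
    · have : (1 : ℝ) ≤ Real.exp (δ / 2 * (∑ b ∈ B, Y b ω - δ * N)) :=
        Real.one_le_exp (mul_nonneg (by linarith) (by linarith))
      linarith [mul_le_mul_of_nonneg_left this hf]
    · have : (1 : ℝ) ≤ Real.exp (δ / 2 * (∑ b ∈ B, -Y b ω - δ * N)) :=
        Real.one_le_exp (mul_nonneg (by linarith)
          (by rw [Finset.sum_neg_distrib]; linarith))
      linarith [mul_le_mul_of_nonneg_left this hf]
  · exact add_nonneg e1 e2

end BiasedCoins

/-! ### Atomic types and aggregation-free formulas -/

section AtomicTypes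

open scoped Classical

/-- The atoms of a relational signature over the set `D`. -/
abbrev Atom (L : FirstOrder.Language.{u, v}) (D : Type*) : Type _ :=
  Σ R : RelSymb L, (Fin R.1 → D)

/-- Complete descriptions of the atomic formulas in `m` variables, consistent or not. -/
abbrev AtomicType (L : FirstOrder.Language.{u, v}) (m : ℕ) : Type v :=
  (Atom L (Fin m) → Prop) × (Fin m → Fin m → Prop)

variable {L : FirstOrder.Language.{u, v}}

/-- The atomic type of a tuple in a structure. -/
def atomicType {D : Type*} (A : L.Structure D) {m : ℕ} (a : Fin m → D) : AtomicType L m :=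
  (fun v => A.RelMap v.1.2 (a ∘ v.2), fun i j => a i = a j)

/-- Substitution of variables in an atomic type. -/
def AtomicType.comap {m m' : ℕ} (u : Fin m' → Fin m) (t : AtomicType L m) : AtomicType L m' :=
  (fun v => t.1 ⟨v.1, u ∘ v.2⟩, fun i j => t.2 (u i) (u j))

theorem atomicType_comp {D : Type*} (A : L.Structure D) {m m' : ℕ} (u : Fin m' → Fin m)
    (a : Fin m → D) : atomicType A (a ∘ u) = (atomicType A a).comap u := rfl

theorem atomicType_eq_iff {D D' : Type*} {A : L.Structure D} {A' : L.Structure D'} {m : ℕ}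
    {a : Fin m → D} {a' : Fin m → D'} :
    atomicType A a = atomicType A' a' ↔
      (∀ (R : RelSymb L) (x : Fin R.1 → Fin m),
        A.RelMap R.2 (a ∘ x) ↔ A'.RelMap R.2 (a' ∘ x)) ∧ ∀ i j, a i = a j ↔ a' i = a' j := by
  constructor
  · intro h
    refine ⟨fun R x => ?_, fun i j => ?_⟩
    · exact iff_of_eq (congrFun (congrArg Prod.fst h) ⟨R, x⟩)
    · exact iff_of_eq (congrFun (congrFun (congrArg Prod.snd h) i) j)
  · rintro ⟨h₁, h₂⟩
    exact Prod.ext (funext fun v => propext (h₁ v.1 v.2))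
      (funext fun i => funext fun j => propext (h₂ i j))

/-- Only the entries of the tuple and the occurring symbols matter. This gives at once that a bias
depends only on parent symbols, that it depends only on atoms over its own tuple, and that it can be
transported between structures of different sizes. -/
theorem PLA.value_congr_of_aggFree {m : ℕ} {φ : PLA L m} (hφ : φ.AggFree) {D D' : Type*}
    [Finite D] [Finite D'] {A : L.Structure D} {A' : L.Structure D'} {a : Fin m → D}
    {a' : Fin m → D'} (he : ∀ i j, a i = a j ↔ a' i = a' j)
    (hr : ∀ R ∈ φ.symbols, ∀ x : Fin R.1 → Fin m,
      A.RelMap R.2 (a ∘ x) ↔ A'.RelMap R.2 (a' ∘ x)) :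
    φ.value A a = φ.value A' a' := by
  induction φ with
  | const c => rfl
  | eq x y => simp only [PLA.value, he]
  | rel R x =>
    have : A.RelMap R.2 (fun i => a (x i)) ↔ A'.RelMap R.2 (fun i => a' (x i)) := hr R rfl x
    simp only [PLA.value, this]
  | neg φ ih => simp only [PLA.value, ih hφ he hr]
  | conj φ ψ ih₁ ih₂ =>
    simp only [PLA.value, ih₁ hφ.1 he fun R hR => hr R (Or.inl hR),
      ih₂ hφ.2 he fun R hR => hr R (Or.inr hR)]
  | disj φ ψ ih₁ ih₂ =>
    simp only [PLA.value, ih₁ hφ.1 he fun R hR => hr R (Or.inl hR),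
      ih₂ hφ.2 he fun R hR => hr R (Or.inr hR)]
  | imp φ ψ ih₁ ih₂ =>
    simp only [PLA.value, ih₁ hφ.1 he fun R hR => hr R (Or.inl hR),
      ih₂ hφ.2 he fun R hR => hr R (Or.inr hR)]
  | wmean φ ψ χ ih₁ ih₂ ih₃ =>
    simp only [PLA.value, ih₁ hφ.1 he fun R hR => hr R (Or.inl (Or.inl hR)),
      ih₂ hφ.2.1 he fun R hR => hr R (Or.inl (Or.inr hR)),
      ih₃ hφ.2.2 he fun R hR => hr R (Or.inr hR)]
  | agg => exact hφ.elim

end AtomicTypes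

/-! ### Conditional probability of an extension by a fresh element -/

section FreshExtensions

open scoped Classical

variable {L : FirstOrder.Language.{u, v}}

/-- Structures for a relational signature are the sets of atoms. -/
def configEquiv (L : FirstOrder.Language.{u, v}) [L.IsRelational] (D : Type*) :
    L.Structure D ≃ (Atom L D → Prop) :=
  (structureEquiv L D).trans
    (Equiv.piCurry (fun (R : RelSymb L) (_ : Fin R.1 → D) => Prop)).symm

/-- The conditional probability of the truth value of an atom, given the smaller atoms. -/
def PLANetwork.factor (G : PLANetwork L) {D : Type*} [Finite D] (A : L.Structure D)
    (v : Atom L D) : ℝ :=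
  bias ((G.θ v.1).value A v.2) (A.RelMap v.1.2 v.2)

theorem PLANetwork.factor_nonneg (G : PLANetwork L) {D : Type*} [Finite D] (A : L.Structure D)
    (v : Atom L D) : 0 ≤ G.factor A v := 
  bias_nonneg (unitInterval.nonneg _) (unitInterval.le_one _) _

theorem PLANetwork.factor_le_one (G : PLANetwork L) {D : Type*} [Finite D] (A : L.Structure D)
    (v : Atom L D) : G.factor A v ≤ 1 := 
  bias_le_one (unitInterval.nonneg _) (unitInterval.le_one _) _

theorem PLANetwork.factor_congr (G : PLANetwork L) (hG : ∀ R, (G.θ R).AggFree) {D D' : Type*}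
    [Finite D] [Finite D'] {A : L.Structure D} {A' : L.Structure D'} {m : ℕ}
    {a : Fin m → D} {a' : Fin m → D'} (h : atomicType A a = atomicType A' a') (R : RelSymb L)
    (y : Fin R.1 → Fin m) : G.factor A ⟨R, a ∘ y⟩ = G.factor A' ⟨R, a' ∘ y⟩ := by
  have h' : atomicType A (a ∘ y) = atomicType A' (a' ∘ y) := by
    rw [atomicType_comp, atomicType_comp, h]
  rw [atomicType_eq_iff] at h h'
  unfold PLANetwork.factor
  rw [PLA.value_congr_of_aggFree (hG R) h'.2 fun S _ x => h'.1 S x]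
  simp only [h.1]

variable [Fintype (RelSymb L)]

theorem PLANetwork.probStructure_eq_prod (G : PLANetwork L) {n : ℕ} (A : L.Structure (Fin n)) :
    G.probStructure n A = ∏ v : Atom L (Fin n), G.factor A v := by
  rw [Fintype.prod_sigma]
  rfl

/-- The atoms over the range of `a` in which the last entry of `a` occurs. -/
def lastAtoms (L : FirstOrder.Language.{u, v}) [Fintype (RelSymb L)] {K n : ℕ}
    (a : Fin (K + 1) → Fin n) : Finset (Atom L (Fin n)) :=
  Finset.univ.filter fun v => Set.range v.2 ⊆ Set.range a ∧ a (Fin.last K) ∈ Set.range v.2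

theorem mem_lastAtoms {K n : ℕ} {a : Fin (K + 1) → Fin n} {v : Atom L (Fin n)} :
    v ∈ lastAtoms L a ↔ Set.range v.2 ⊆ Set.range a ∧ a (Fin.last K) ∈ Set.range v.2 := by
  simp [lastAtoms]

theorem exists_eq_comp_of_range_subset {α β γ : Type*} {f : α → γ} {g : β → γ}
    (h : Set.range f ⊆ Set.range g) : ∃ y : α → β, f = g ∘ y := by
  choose y hy using fun i => h (Set.mem_range_self i)
  exact ⟨y, funext fun i => (hy i).symm⟩

theorem exists_eq_of_mem_lastAtoms {K n : ℕ} {a : Fin (K + 1) → Fin n} {v : Atom L (Fin n)}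
    (hv : v ∈ lastAtoms L a) :
    ∃ (R : RelSymb L) (y : Fin R.1 → Fin (K + 1)), v = ⟨R, a ∘ y⟩ := by
  obtain ⟨R, x⟩ := v
  obtain ⟨y, hy⟩ := exists_eq_comp_of_range_subset (mem_lastAtoms.1 hv).1
  exact ⟨R, y, congrArg (Sigma.mk R) hy⟩

theorem exists_comp_eq_of_kernel {α β γ : Type*} [Nonempty α] {f : α → β} {g : α → γ}
    (h : ∀ i j, f i = f j ↔ g i = g j) : ∃ σ : β → γ, σ ∘ f = g :=
  ⟨g ∘ Function.invFun f, funext fun i => (h _ _).1 (Function.invFun_eq ⟨i, rfl⟩)⟩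

/-- Equal types have equal equality patterns, so the two ranges are in bijection. The maps `σ` and
`τ` are mutually inverse there (elsewhere they are arbitrary), and they carry atoms to atoms with
the same factor. -/
theorem PLANetwork.prod_factor_lastAtoms_congr (G : PLANetwork L) (hG : ∀ R, (G.θ R).AggFree)
    {K n n' : ℕ} {A : L.Structure (Fin n)} {A' : L.Structure (Fin n')}
    {a : Fin (K + 1) → Fin n} {a' : Fin (K + 1) → Fin n'}
    (h : atomicType A a = atomicType A' a') :
    ∏ v ∈ lastAtoms L a, G.factor A v = ∏ v ∈ lastAtoms L a', G.factor A' v := by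
  have hk := (atomicType_eq_iff.1 h).2
  obtain ⟨σ, hσ⟩ := exists_comp_eq_of_kernel hk
  obtain ⟨τ, hτ⟩ := exists_comp_eq_of_kernel fun i j => (hk i j).symm
  have hmap : ∀ {k k' : ℕ} {b : Fin (K + 1) → Fin k} {b' : Fin (K + 1) → Fin k'}
      {s : Fin k → Fin k'}, s ∘ b = b' → ∀ v ∈ lastAtoms L b,
        (⟨v.1, s ∘ v.2⟩ : Atom L (Fin k')) ∈ lastAtoms L b' := by
    intro k k' b b' s hs v hv
    rw [mem_lastAtoms] at hv ⊢
    obtain ⟨h₁, i, hi⟩ := hv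
    refine ⟨?_, i, ?_⟩
    · rw [← hs, Set.range_comp, Set.range_comp]
      exact Set.image_mono h₁
    · rw [← hs]; simp [hi]
  have hinv : ∀ {k k' : ℕ} {b : Fin (K + 1) → Fin k} {b' : Fin (K + 1) → Fin k'}
      {s : Fin k → Fin k'} {s' : Fin k' → Fin k}, s ∘ b = b' → s' ∘ b' = b →
      ∀ v ∈ lastAtoms L b, (⟨v.1, s' ∘ (s ∘ v.2)⟩ : Atom L (Fin k)) = v := by
    rintro k k' b b' s s' hs hs' v hv
    obtain ⟨R, y, rfl⟩ := exists_eq_of_mem_lastAtoms hv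
    dsimp only
    rw [← Function.comp_assoc s, hs, ← Function.comp_assoc, hs']
  refine Finset.prod_bij' (fun v _ => ⟨v.1, σ ∘ v.2⟩) (fun v _ => ⟨v.1, τ ∘ v.2⟩)
    (hmap hσ) (hmap hτ) (hinv hσ hτ) (hinv hτ hσ) ?_
  intro v hv
  obtain ⟨R, y, rfl⟩ := exists_eq_of_mem_lastAtoms hv
  dsimp only
  rw [← Function.comp_assoc σ, hσ]
  exact G.factor_congr hG h R y

/-- The type `q` says that the last variable is different from the others and is realized in some
structure. -/
def AtomicType.FreshRealizable {K : ℕ} (q : AtomicType L (K + 1)) : Prop :=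
  ∃ (n : ℕ) (A : L.Structure (Fin n)) (a : Fin (K + 1) → Fin n),
    (∀ i : Fin K, a i.castSucc ≠ a (Fin.last K)) ∧ atomicType A a = q

/-- The conditional probability that a new element extends a tuple to a tuple of type `q`. -/
def PLANetwork.freshWeight (G : PLANetwork L) {K : ℕ} (q : AtomicType L (K + 1)) : ℝ :=
  if h : q.FreshRealizable then
    ∏ v ∈ lastAtoms L h.choose_spec.choose_spec.choose, G.factor h.choose_spec.choose v
  else 0

theorem PLANetwork.freshWeight_nonneg (G : PLANetwork L) {K : ℕ} (q : AtomicType L (K + 1)) :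
    0 ≤ G.freshWeight q := by
  unfold PLANetwork.freshWeight
  split_ifs
  · exact Finset.prod_nonneg fun _ _ => G.factor_nonneg _ _
  · exact le_rfl

theorem PLANetwork.freshWeight_le_one (G : PLANetwork L) {K : ℕ} (q : AtomicType L (K + 1)) :
    G.freshWeight q ≤ 1 := by
  unfold PLANetwork.freshWeight
  split_ifs
  · exact Finset.prod_le_one (fun _ _ => G.factor_nonneg _ _) fun _ _ => G.factor_le_one _ _
  · exact zero_le_one

theorem PLANetwork.freshWeight_eq (G : PLANetwork L) (hG : ∀ R, (G.θ R).AggFree) {K n : ℕ}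
    {A : L.Structure (Fin n)} {a : Fin (K + 1) → Fin n}
    (ha : ∀ i : Fin K, a i.castSucc ≠ a (Fin.last K)) {q : AtomicType L (K + 1)}
    (hq : atomicType A a = q) : G.freshWeight q = ∏ v ∈ lastAtoms L a, G.factor A v := by
  have h : q.FreshRealizable := ⟨n, A, a, ha, hq⟩
  rw [PLANetwork.freshWeight, dif_pos h]
  exact G.prod_factor_lastAtoms_congr hG
    (h.choose_spec.choose_spec.choose_spec.2.trans hq.symm)

/-- A structure of nonzero probability has no vanishing factor. Admissibility speaks only of
positive frequencies, so types of weight `0` have to be excluded later. -/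
theorem PLANetwork.freshWeight_pos (G : PLANetwork L) (hG : ∀ R, (G.θ R).AggFree) {K n : ℕ}
    {A : L.Structure (Fin n)} (hA : G.probStructure n A ≠ 0) {a : Fin (K + 1) → Fin n}
    (ha : ∀ i : Fin K, a i.castSucc ≠ a (Fin.last K)) : 0 < G.freshWeight (atomicType A a) := by
  rw [G.freshWeight_eq hG ha rfl]
  rw [G.probStructure_eq_prod, Finset.prod_ne_zero_iff] at hA
  exact Finset.prod_pos fun v _ => (G.factor_nonneg A v).lt_of_ne' (hA v (Finset.mem_univ _))

/-- Given a compatible base, exactly one configuration of the last atoms realizes `q`, and its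
conditional probability is `freshWeight q`. Thus the density of the coins times the indicator of `q`
equals `freshWeight q` times the density of deterministic coins, on the event that the base is
right. Both kinds of coins integrate out to `1`. -/
theorem sum_fresh_centered (G : PLANetwork L) (hG : ∀ R, (G.θ R).AggFree) [L.IsRelational]
    (hr : ∀ n, WellFounded fun v w : Atom L (Fin n) => Relation.TransGen G.edge w.1 v.1)
    {g : ∀ n, Atom L (Fin n) → (Atom L (Fin n) → Prop) → ℝ}
    (hgdef : ∀ n v ω, g n v ω = (G.θ v.1).value ((configEquiv L (Fin n)).symm ω) v.2)
    (hg : ∀ n v, DependsOn (g n v) {w | Relation.TransGen G.edge w.1 v.1})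
    {K n : ℕ} (a : Fin (K + 1) → Fin n) (ha : ∀ i : Fin K, a i.castSucc ≠ a (Fin.last K))
    (q : AtomicType L (K + 1)) (h : (Atom L (Fin n) → Prop) → ℝ)
    (hh : DependsOn h (lastAtoms L a : Set (Atom L (Fin n)))ᶜ) :
    ∑ ω, h ω * (∏ v ∈ lastAtoms L a, (2 * bias (g n v ω) (ω v))) *
      ((if atomicType ((configEquiv L (Fin n)).symm ω) a = q then 1 else 0) -
        if atomicType ((configEquiv L (Fin n)).symm ω) (a ∘ Fin.castSucc) =
          q.comap Fin.castSucc then G.freshWeight q else 0) = 0 := by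
  set S := (configEquiv L (Fin n)).symm
  by_cases hq : q.FreshRealizable
  swap
  · refine Finset.sum_eq_zero fun ω _ => ?_
    rw [if_neg fun h' => hq ⟨n, S ω, a, ha, h'⟩, PLANetwork.freshWeight, dif_neg hq]
    simp
  by_cases hker : ∀ i j : Fin K, a i.castSucc = a j.castSucc ↔ q.2 i.castSucc j.castSucc
  swap
  · refine Finset.sum_eq_zero fun ω _ => ?_
    have hne : atomicType (S ω) (a ∘ Fin.castSucc) ≠ q.comap Fin.castSucc := fun h' =>
      hker fun i j => iff_of_eq (congrFun (congrFun (congrArg Prod.snd h') i) j)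
    rw [if_neg hne, if_neg]
    · simp
    · rintro rfl
      exact hne rfl
  obtain ⟨n₁, A₁, a₁, ha₁, rfl⟩ := hq
  have hk : ∀ i j, a i = a j ↔ a₁ i = a₁ j := by
    intro i j
    induction i using Fin.lastCases with
    | last =>
      induction j using Fin.lastCases with
      | last => simp
      | cast j => exact iff_of_false (ha j).symm (ha₁ j).symm
    | cast i =>
      induction j using Fin.lastCases with
      | last => exact iff_of_false (ha i) (ha₁ i)
      | cast j => exact hker i j
  obtain ⟨σ, hσ⟩ := exists_comp_eq_of_kernel hk
  -- The deterministic coins: they force the last atoms to copy the chosen realization `a₁` of the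
  -- type.
  set η : Atom L (Fin n) → ℝ := fun v => if A₁.RelMap v.1.2 (σ ∘ v.2) then 1 else 0 with hη
  set w := G.freshWeight (atomicType A₁ a₁) with hw
  set I : (Atom L (Fin n) → Prop) → ℝ := fun ω =>
    if atomicType (S ω) (a ∘ Fin.castSucc) = (atomicType A₁ a₁).comap Fin.castSucc then w else 0
    with hI
  have hIdep : DependsOn I (lastAtoms L a : Set (Atom L (Fin n)))ᶜ := by
    intro ω ω' hω
    have : atomicType (S ω) (a ∘ Fin.castSucc) = atomicType (S ω') (a ∘ Fin.castSucc) := by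
      rw [atomicType_eq_iff]
      refine ⟨fun R x => iff_of_eq (hω ⟨R, _⟩ fun hx => ?_), fun _ _ => Iff.rfl⟩
      obtain ⟨i, hi⟩ := (mem_lastAtoms.1 hx).2
      exact ha _ hi
    simp only [hI, this]
  have hpt : ∀ ω, (∏ v ∈ lastAtoms L a, (2 * bias (g n v ω) (ω v))) *
      (if atomicType (S ω) a = atomicType A₁ a₁ then 1 else 0) =
      I ω * ∏ v ∈ lastAtoms L a, (2 * bias (η v) (ω v)) := by
    intro ω
    by_cases h₁ : atomicType (S ω) a = atomicType A₁ a₁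
    · have h₂ : I ω = w := if_pos (by rw [atomicType_comp, h₁])
      rw [if_pos h₁, h₂, hw, G.freshWeight_eq hG ha h₁, Finset.prod_mul_distrib,
        Finset.prod_mul_distrib]
      have h₃ : ∏ v ∈ lastAtoms L a, bias (η v) (ω v) = 1 := by
        refine Finset.prod_eq_one ?_
        intro v hv
        obtain ⟨R, y, rfl⟩ := exists_eq_of_mem_lastAtoms hv
        have : ω ⟨R, a ∘ y⟩ ↔ A₁.RelMap R.2 (a₁ ∘ y) := (atomicType_eq_iff.1 h₁).1 R y
        simp only [hη, ← Function.comp_assoc, hσ, this, bias]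
        split_ifs <;> simp
      have h₄ : ∀ v, bias (g n v ω) (ω v) = G.factor (S ω) v := fun v => by
        rw [hgdef]; rfl
      simp only [h₃, h₄]
      ring
    · rw [if_neg h₁, mul_zero]
      by_cases h₂ : atomicType (S ω) (a ∘ Fin.castSucc) = (atomicType A₁ a₁).comap Fin.castSucc
      swap
      · simp only [hI, if_neg h₂, zero_mul]
      rw [Finset.prod_eq_zero_iff.2, mul_zero]
      -- If every last atom agreed with its deterministic coin, then, the base being right, the
      -- whole type would be the prescribed one.
      by_contra hcon
      push Not at hcon
      refine h₁ (atomicType_eq_iff.2 ⟨fun R y => ?_, hk⟩)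
      by_cases hy : Fin.last K ∈ Set.range y
      · have hv : (⟨R, a ∘ y⟩ : Atom L (Fin n)) ∈ lastAtoms L a := by
          obtain ⟨i, hi⟩ := hy
          exact mem_lastAtoms.2 ⟨Set.range_comp_subset_range y a, i, by simp [hi]⟩
        have := hcon _ hv
        simp only [hη, ← Function.comp_assoc, hσ, bias] at this
        change ω ⟨R, a ∘ y⟩ ↔ _
        by_contra hne
        split_ifs at this <;> simp_all
      · obtain ⟨z, rfl⟩ : ∃ z : Fin R.1 → Fin K, y = Fin.castSucc ∘ z := by
          refine exists_eq_comp_of_range_subset ?_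
          rintro j ⟨i, rfl⟩
          obtain ⟨z, hz⟩ := Fin.exists_castSucc_eq.2 fun h' => hy ⟨i, h'⟩
          exact ⟨z, hz⟩
        exact (atomicType_eq_iff (a' := a₁ ∘ Fin.castSucc).1 h₂).1 R z
  have e : ∀ ω, h ω * (∏ v ∈ lastAtoms L a, (2 * bias (g n v ω) (ω v))) *
      ((if atomicType (S ω) a = atomicType A₁ a₁ then 1 else 0) - I ω) =
      (h ω * I ω) * ∏ v ∈ lastAtoms L a, (2 * bias (η v) (ω v)) -
      (h ω * I ω) * ∏ v ∈ lastAtoms L a, (2 * bias (g n v ω) (ω v)) := fun ω => by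
    linear_combination h ω * hpt ω
  rw [Finset.sum_congr rfl fun ω _ => e ω, Finset.sum_sub_distrib,
    sum_mul_prod_two_bias (g := fun v _ => η v) (hr n) _ (fun _ _ _ _ _ => rfl) _
      (dependsOn_mul hh hIdep),
    sum_mul_prod_two_bias (hr n) _ (fun v _ => hg n v) _ (dependsOn_mul hh hIdep), sub_self]

end FreshExtensions

/-! ### Uniform counts of fresh extensions with high probability -/

section HighProbability

open scoped Classical

variable {L : FirstOrder.Language.{u, v}} [Fintype (RelSymb L)]

theorem PLANetwork.probStructure_nonneg (G : PLANetwork L) {n : ℕ} (A : L.Structure (Fin n)) :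
    0 ≤ G.probStructure n A := by
  rw [G.probStructure_eq_prod]
  exact Finset.prod_nonneg fun _ _ => G.factor_nonneg _ _

variable [L.IsRelational]

theorem PLANetwork.prob_eq_sum (G : PLANetwork L) {n : ℕ} (E : Set (L.Structure (Fin n))) :
    G.prob n E = ∑ A, if A ∈ E then G.probStructure n A else 0 := by
  simp only [PLANetwork.prob, Set.indicator_apply]

theorem PLANetwork.prob_nonneg (G : PLANetwork L) {n : ℕ} (E : Set (L.Structure (Fin n))) :
    0 ≤ G.prob n E :=
  Finset.sum_nonneg fun _ _ => Set.indicator_nonneg (fun _ _ => G.probStructure_nonneg _) _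

/-- Null structures are disregarded on purpose: only on the others do all realized types have
positive weight. -/
theorem PLANetwork.prob_mono (G : PLANetwork L) {n : ℕ} {E F : Set (L.Structure (Fin n))}
    (h : ∀ A, G.probStructure n A ≠ 0 → A ∈ E → A ∈ F) : G.prob n E ≤ G.prob n F := by
  rw [G.prob_eq_sum, G.prob_eq_sum]
  refine Finset.sum_le_sum fun A _ => ?_
  have := G.probStructure_nonneg A
  by_cases hA : G.probStructure n A = 0
  · simp [hA]
  · have := h A hA
    split_ifs <;> first | assumption | exact le_rfl | tauto

theorem PLANetwork.prob_exists_le (G : PLANetwork L) {n : ℕ} {ι : Type*} [Fintype ι]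
    (E : ι → Set (L.Structure (Fin n))) :
    G.prob n {A | ∃ i, A ∈ E i} ≤ ∑ i, G.prob n (E i) := by
  simp only [G.prob_eq_sum]
  rw [Finset.sum_comm]
  refine Finset.sum_le_sum fun A _ => ?_
  have h0 := G.probStructure_nonneg A
  have hnn : ∀ i ∈ Finset.univ, 0 ≤ if A ∈ E i then G.probStructure n A else 0 := fun i _ => by
    split_ifs <;> first | assumption | exact le_rfl
  split_ifs with h
  · obtain ⟨i, hi⟩ := h
    refine le_trans ?_ (Finset.single_le_sum hnn (Finset.mem_univ i))
    rw [if_pos hi]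
  · exact Finset.sum_nonneg hnn

/-- The property `P` holds with probability tending to `1`. -/
def PLANetwork.WHP (G : PLANetwork L) (P : ∀ n, L.Structure (Fin n) → Prop) : Prop :=
  Tendsto (fun n => G.prob n {A | ¬ P n A}) atTop (𝓝 0)

variable {G : PLANetwork L}

theorem PLANetwork.WHP.mono {P Q : ∀ n, L.Structure (Fin n) → Prop} (hP : G.WHP P)
    (h : ∀ᶠ n in atTop, ∀ A, G.probStructure n A ≠ 0 → P n A → Q n A) : G.WHP Q :=
  squeeze_zero' (Eventually.of_forall fun _ => G.prob_nonneg _)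
    (h.mono fun _ hn => G.prob_mono fun A hA hQ hP => hQ (hn A hA hP)) hP

theorem PLANetwork.WHP.forall {ι : Type*} [Finite ι] {P : ι → ∀ n, L.Structure (Fin n) → Prop}
    (hP : ∀ i, G.WHP (P i)) : G.WHP fun n A => ∀ i, P i n A := by
  have := Fintype.ofFinite ι
  have h0 : Tendsto (fun n => ∑ i, G.prob n {A | ¬ P i n A}) atTop (𝓝 0) := by
    simpa using tendsto_finsetSum Finset.univ fun i _ => hP i
  refine squeeze_zero (fun _ => G.prob_nonneg _) (fun n => ?_) h0
  refine le_trans (G.prob_mono ?_) (G.prob_exists_le fun i => {A | ¬ P i n A})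
  intro A _ hA
  simpa using hA

theorem PLANetwork.WHP.and {P Q : ∀ n, L.Structure (Fin n) → Prop} (hP : G.WHP P)
    (hQ : G.WHP Q) : G.WHP fun n A => P n A ∧ Q n A := by
  have h : ∀ b : Bool, G.WHP fun n A => if b then P n A else Q n A := fun b => by
    cases b <;> simpa
  refine (PLANetwork.WHP.forall h).mono (Eventually.of_forall fun n A _ hA => ?_)
  exact ⟨by simpa using hA true, by simpa using hA false⟩

theorem PLANetwork.whp_of_eventually {P : ∀ n, L.Structure (Fin n) → Prop}
    (h : ∀ᶠ n in atTop, ∀ A, G.probStructure n A ≠ 0 → P n A) : G.WHP P := by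
  have h0 : G.WHP fun _ _ => True := by
    simp [PLANetwork.WHP, PLANetwork.prob]
  exact h0.mono (h.mono fun n hn A hA _ => hn A hA)

/-- The tail bound with `C₀` the atoms over `a` and one block `lastAtoms L (Fin.snoc a b)` for each
fresh `b`. Two blocks are disjoint because an atom over `a` and `b` cannot mention another fresh
element. -/
theorem PLANetwork.prob_fresh_deviation_le (G : PLANetwork L) (hG : ∀ R, (G.θ R).AggFree)
    {K n : ℕ} (a : Fin K → Fin n) (q : AtomicType L (K + 1)) {δ : ℝ} (hδ₀ : 0 ≤ δ) (hδ₁ : δ ≤ 1) :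
    G.prob n {A | δ * n < |∑ b ∈ Finset.univ.filter fun b => ∀ i, a i ≠ b,
      (((if atomicType A (Fin.snoc a b : Fin (K + 1) → Fin n) = q then 1 else 0) -
        if atomicType A a = q.comap Fin.castSucc then G.freshWeight q else 0 : ℝ))|} ≤
      2 * Real.exp (-(δ ^ 2 / 4) * n) := by
  set g : ∀ n, Atom L (Fin n) → (Atom L (Fin n) → Prop) → ℝ := fun n v ω =>
    (G.θ v.1).value ((configEquiv L (Fin n)).symm ω) v.2 with hgdef
  have hr : ∀ n, WellFounded fun v w : Atom L (Fin n) => Relation.TransGen G.edge w.1 v.1 := by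
    intro n
    have : IsTrans (Atom L (Fin n)) fun v w => Relation.TransGen G.edge w.1 v.1 :=
      ⟨fun _ _ _ h₁ h₂ => h₂.trans h₁⟩
    have : Std.Irrefl fun v w : Atom L (Fin n) => Relation.TransGen G.edge w.1 v.1 :=
      ⟨fun v => G.acyclic v.1⟩
    exact Finite.wellFounded_of_trans_of_irrefl _
  have hg : ∀ n v, DependsOn (g n v) {w | Relation.TransGen G.edge w.1 v.1} := by
    intro n v ω ω' h
    refine congrArg Subtype.val (PLA.value_congr_of_aggFree (hG v.1) (fun _ _ => Iff.rfl) fun R hR x => ?_)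
    exact iff_of_eq (h ⟨R, _⟩ (Relation.TransGen.single (G.symbols_θ _ R hR)))
  have hg' : ∀ n v, DependsOn (g n v) {w | Set.range w.2 ⊆ Set.range v.2} := by
    intro n v ω ω' h
    refine congrArg Subtype.val (PLA.value_congr_of_aggFree (hG v.1) (fun _ _ => Iff.rfl) fun R hR x => ?_)
    exact iff_of_eq (h ⟨R, _⟩ (Set.range_comp_subset_range x v.2))
  set C₀ : Finset (Atom L (Fin n)) := Finset.univ.filter fun v => Set.range v.2 ⊆ Set.range a
    with hC₀
  set s : Fin n → Fin (K + 1) → Fin n := fun b => Fin.snoc a b with hs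
  have hsr : ∀ b, Set.range (s b) = insert b (Set.range a) := fun b => by
    simp only [hs, Fin.range_snoc]
  have hsl : ∀ b, s b (Fin.last K) = b := fun b => by simp [hs]
  have hsc : ∀ b, s b ∘ Fin.castSucc = a := fun b => by ext i; simp [hs]
  have hmemC : ∀ b v, v ∈ lastAtoms L (s b) ↔
      Set.range v.2 ⊆ insert b (Set.range a) ∧ b ∈ Set.range v.2 := fun b v => by
    rw [mem_lastAtoms, hsr, hsl]
  have hunion : ∀ b v, Set.range v.2 ⊆ insert b (Set.range a) →
      v ∈ (C₀ ∪ lastAtoms L (s b) : Set (Atom L (Fin n))) := by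
    intro b v hv
    by_cases hb : b ∈ Set.range v.2
    · exact Or.inr ((hmemC b v).2 ⟨hv, hb⟩)
    · refine Or.inl ?_
      simpa [hC₀] using (Set.subset_insert_iff_of_notMem hb).1 hv
  have hfresh : ∀ b, (∀ i, a i ≠ b) → b ∉ Set.range a := by
    rintro b hb ⟨i, hi⟩; exact hb i hi
  have main := sum_prod_bias_tail_le (g := g n) (hr n) (hg n)
    (fun v ω => unitInterval.nonneg _) (fun v ω => unitInterval.le_one _)
    (Finset.univ.filter fun b => ∀ i, a i ≠ b) C₀ (fun b => lastAtoms L (s b))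
    (by
      intro b hb
      refine Finset.disjoint_left.2 fun v hv hv' => ?_
      simp only [hC₀, Finset.mem_filter, Finset.mem_univ, true_and] at hv hb
      exact hfresh b hb (hv ((hmemC b v).1 hv').2))
    (by
      intro b hb b' hb' hne
      refine Finset.disjoint_left.2 fun v hv hv' => ?_
      simp only [Finset.mem_filter, Finset.mem_univ, true_and] at hb'
      rcases ((hmemC b v).1 hv).1 ((hmemC b' v).1 hv').2 with h | h
      · exact hne h.symm
      · exact hfresh b' hb' h)
    (by
      intro v hv
      refine (hg' n v).subset fun w hw => ?_
      simp only [hC₀, Finset.coe_filter, Finset.mem_filter, Finset.mem_univ, true_and,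
        Set.mem_ofPred_eq] at hv hw ⊢
      exact hw.trans hv)
    (by
      intro b _ v hv
      exact (hg' n v).subset fun w hw => hunion b w (hw.trans ((hmemC b v).1 hv).1))
    (fun b ω => (if atomicType ((configEquiv L (Fin n)).symm ω) (s b) = q then 1 else 0) -
        if atomicType ((configEquiv L (Fin n)).symm ω) a = q.comap Fin.castSucc then
          G.freshWeight q else 0)
    (by
      intro b _ ω ω' h
      have : atomicType ((configEquiv L (Fin n)).symm ω) (s b) =
          atomicType ((configEquiv L (Fin n)).symm ω') (s b) := by
        refine atomicType_eq_iff.2 ⟨fun R x => iff_of_eq (h ⟨R, _⟩ (hunion b _ ?_)),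
          fun _ _ => Iff.rfl⟩
        rw [← hsr]
        exact Set.range_comp_subset_range x (s b)
      have h' : atomicType ((configEquiv L (Fin n)).symm ω) a =
          atomicType ((configEquiv L (Fin n)).symm ω') a := by
        rw [← hsc b, atomicType_comp, atomicType_comp, this]
      simp only [this, h'])
    (by
      intro b _ ω
      have h0 := G.freshWeight_nonneg q
      have h1 := G.freshWeight_le_one q
      rw [abs_le]
      split_ifs <;> constructor <;> linarith)
    (by
      intro b hb h hh
      simp only [Finset.mem_filter, Finset.mem_univ, true_and] at hb
      have := sum_fresh_centered G hG hr (g := g) (fun _ _ _ => rfl) hg (s b)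
        (fun i => by simpa [hs] using hb i) q h hh
      rwa [hsc] at this)
    (N := n) hδ₀ hδ₁ (by
      exact_mod_cast (Finset.card_le_univ _).trans_eq (Fintype.card_fin n))
  refine le_trans (le_of_eq ?_) main
  rw [G.prob_eq_sum]
  refine Fintype.sum_equiv (configEquiv L (Fin n)) _ _ fun A => ?_
  rw [G.probStructure_eq_prod]
  simp only [Equiv.symm_apply_apply, Set.mem_ofPred_eq, hs, hgdef]
  rfl

theorem le_card_fresh_add {K n : ℕ} (a : Fin K → Fin n) :
    n ≤ (Finset.univ.filter fun b => ∀ i, a i ≠ b).card + K := by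
  set B : Finset (Fin n) := Finset.univ.filter fun b => ∀ i, a i ≠ b with hB
  have : Bᶜ ⊆ Finset.univ.image a := fun b hb => by
    simpa [hB] using hb
  have h2 := (Finset.card_le_card this).trans Finset.card_image_le
  have h3 := Finset.card_add_card_compl B
  simp only [Finset.card_univ, Fintype.card_fin] at h2 h3
  omega

/-- Union bound: `n ^ K` tuples and a fixed number of types against an exponentially small
probability. -/
theorem PLANetwork.whp_fresh_saturated (G : PLANetwork L) (hG : ∀ R, (G.θ R).AggFree) (K : ℕ)
    {δ : ℝ} (hδ : 0 < δ) :
    G.WHP fun n A => ∀ (a : Fin K → Fin n) (q : AtomicType L (K + 1)),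
      |((Finset.univ.filter fun b => (∀ i, a i ≠ b) ∧
          atomicType A (Fin.snoc a b : Fin (K + 1) → Fin n) = q).card : ℝ) / n -
        if atomicType A a = q.comap Fin.castSucc then G.freshWeight q else 0| ≤ δ := by
  have := Fintype.ofFinite (AtomicType L (K + 1))
  set ε := min (δ / 2) 1 with hε
  have hε₀ : 0 < ε := lt_min (by linarith) one_pos
  have h1 : G.WHP fun n A => ∀ p : (Fin K → Fin n) × AtomicType L (K + 1),
      |∑ b ∈ Finset.univ.filter fun b => ∀ i, p.1 i ≠ b,
      (((if atomicType A (Fin.snoc p.1 b : Fin (K + 1) → Fin n) = p.2 then 1 else 0) -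
        if atomicType A p.1 = p.2.comap Fin.castSucc then G.freshWeight p.2 else 0 : ℝ))| ≤
        ε * n := by
    have hlim : Tendsto (fun n : ℕ => (2 * Fintype.card (AtomicType L (K + 1)) : ℝ) *
        ((n : ℝ) ^ K / Real.exp (ε ^ 2 / 4 * n))) atTop (𝓝 0) := by
      have := ((isLittleO_pow_exp_pos_mul_atTop K
        (show 0 < ε ^ 2 / 4 by positivity)).tendsto_div_nhds_zero.comp
          tendsto_natCast_atTop_atTop).const_mul
            (2 * Fintype.card (AtomicType L (K + 1)) : ℝ)
      simpa using this
    refine squeeze_zero (fun _ => G.prob_nonneg _) (fun n => ?_) hlim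
    refine le_trans (G.prob_mono (F := {A | ∃ p : (Fin K → Fin n) × AtomicType L (K + 1),
      A ∈ {A | ε * n < |∑ b ∈ Finset.univ.filter fun b => ∀ i, p.1 i ≠ b,
      (((if atomicType A (Fin.snoc p.1 b : Fin (K + 1) → Fin n) = p.2 then 1 else 0) -
        if atomicType A p.1 = p.2.comap Fin.castSucc then G.freshWeight p.2 else 0 : ℝ))|}})
        fun A _ hA => ?_) ((G.prob_exists_le _).trans ?_)
    · by_contra hcon
      exact hA fun p => not_lt.1 fun h => hcon ⟨p, h⟩
    · refine (Finset.sum_le_sum fun p _ => G.prob_fresh_deviation_le hG p.1 p.2 hε₀.le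
        (min_le_right _ _)).trans (le_of_eq ?_)
      rw [Finset.sum_const, Finset.card_univ, Fintype.card_prod, Fintype.card_fun, neg_mul,
        Real.exp_neg]
      simp
      ring
  refine h1.mono ?_
  -- Half of `δ` absorbs the at most `K` entries of `a`, which are not fresh; the other half is the
  -- random deviation.
  have hev : ∀ᶠ n : ℕ in atTop, 2 * (K + 1) / δ ≤ (n : ℝ) :=
    tendsto_natCast_atTop_atTop.eventually_ge_atTop _
  filter_upwards [hev] with n hn A _ h a q
  have hn0 : (0 : ℝ) < n := lt_of_lt_of_le (by positivity) hn
  have hKn : (K : ℝ) ≤ δ / 2 * n := by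
    rw [div_le_iff₀ hδ] at hn; linarith
  specialize h (a, q)
  set B : Finset (Fin n) := Finset.univ.filter fun b => ∀ i, a i ≠ b with hB
  set W := if atomicType A a = q.comap Fin.castSucc then G.freshWeight q else 0 with hW
  have hW0 : 0 ≤ W := by
    rw [hW]; split_ifs; exacts [G.freshWeight_nonneg q, le_rfl]
  have hW1 : W ≤ 1 := by
    rw [hW]; split_ifs; exacts [G.freshWeight_le_one q, zero_le_one]
  have hBn : (B.card : ℝ) ≤ n := by
    exact_mod_cast (Finset.card_le_univ _).trans_eq (Fintype.card_fin n)
  have hBK : (n : ℝ) ≤ B.card + K := by exact_mod_cast le_card_fresh_add a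
  have hsum : ∑ b ∈ B, (((if atomicType A (Fin.snoc a b : Fin (K + 1) → Fin n) = q then 1 else 0) -
      W : ℝ)) = ((Finset.univ.filter fun b => (∀ i, a i ≠ b) ∧
          atomicType A (Fin.snoc a b : Fin (K + 1) → Fin n) = q).card : ℝ) - B.card * W := by
    rw [Finset.sum_sub_distrib, Finset.sum_boole, Finset.filter_filter]
    simp
  simp only at h
  rw [hsum] at h
  set c := ((Finset.univ.filter fun b => (∀ i, a i ≠ b) ∧
          atomicType A (Fin.snoc a b : Fin (K + 1) → Fin n) = q).card : ℝ)
  have hεδ : ε * n ≤ δ / 2 * n := mul_le_mul_of_nonneg_right (min_le_left _ _) hn0.le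
  have key : |c - n * W| ≤ δ * n := by
    rw [abs_le] at h ⊢
    have h4 := mul_le_mul_of_nonneg_right hBn hW0
    have h5 := mul_le_mul_of_nonneg_right hBK hW0
    have h6 := mul_le_mul_of_nonneg_left hW1 (Nat.cast_nonneg (α := ℝ) K)
    constructor <;> nlinarith
  have : c / n - W = (c - n * W) / n := by field_simp
  rw [this, abs_div, abs_of_pos hn0, div_le_iff₀ hn0]
  exact key

end HighProbability

/-! ### Counts of extensions by several elements -/

section Saturation

open scoped Classical

variable {L : FirstOrder.Language.{u, v}}

/-- The equalities between the entries of `c` are those described by `e`. -/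
def MatchesEq {m : ℕ} {D : Type*} (e : Setoid (Fin m)) (c : Fin m → D) : Prop :=
  ∀ i j, e.r i j ↔ c i = c j

theorem matchesEq_iff {m : ℕ} {D : Type*} {e : Setoid (Fin m)} {c : Fin m → D}
    {A : L.Structure D} : MatchesEq e c ↔ (atomicType A c).2 = fun i j => e.r i j := by
  constructor
  · exact fun h => funext fun i => funext fun j => propext (h i j).symm
  · exact fun h i j => (iff_of_eq (congrFun (congrFun h i) j)).symm

theorem MatchesEq.comp {m m' : ℕ} {D : Type*} {e : Setoid (Fin m)} {c : Fin m → D}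
    (h : MatchesEq e c) (u : Fin m' → Fin m) : MatchesEq (e.comap u) (c ∘ u) :=
  fun i j => h (u i) (u j)

theorem matchesEq_iff_castSucc {K : ℕ} {D : Type*} {e : Setoid (Fin (K + 1))}
    {c : Fin (K + 1) → D} :
    MatchesEq e c ↔ MatchesEq (e.comap Fin.castSucc) (c ∘ Fin.castSucc) ∧
      ∀ i : Fin K, e.r i.castSucc (Fin.last K) ↔ c i.castSucc = c (Fin.last K) := by
  refine ⟨fun h => ⟨h.comp _, fun i => h _ _⟩, fun ⟨h₁, h₂⟩ i j => ?_⟩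
  induction i using Fin.lastCases with
  | last =>
    induction j using Fin.lastCases with
    | last => exact iff_of_true (e.refl _) rfl
    | cast j => exact ⟨fun h => ((h₂ j).1 (e.symm h)).symm, fun h => e.symm ((h₂ j).2 h.symm)⟩
  | cast i =>
    induction j using Fin.lastCases with
    | last => exact h₂ i
    | cast j => exact h₁ i j

theorem card_filter_snoc {α : Type*} [Fintype α] {l : ℕ} (P : (Fin (l + 1) → α) → Prop) :
    (Finset.univ.filter P).card = ∑ b : Fin l → α,
      (Finset.univ.filter fun x => P (Fin.snoc b x)).card := by
  simp only [Finset.card_filter]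
  rw [← Fintype.sum_prod_type' (f := fun (b : Fin l → α) (x : α) =>
    if P (Fin.snoc b x) then 1 else 0), ← (Equiv.prodComm _ _).sum_comp]
  exact (Fintype.sum_equiv (Fin.snocEquiv fun _ => α) _ _ fun _ => rfl).symm

variable [Fintype (RelSymb L)] [L.IsRelational] {G : PLANetwork L}

/-- If `e` identifies the last variable with an earlier one, the extension is forced: `d = 0`, and
the weight is `1` or `0` according to whether `q` is the type of a tuple with that entry repeated.
Otherwise the new element is fresh: `d = 1` and the weight is `freshWeight`. -/
theorem exists_snoc_weight (hG : ∀ R, (G.θ R).AggFree) {K : ℕ} (e : Setoid (Fin (K + 1))) :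
    ∃ (d : ℕ) (w : AtomicType L (K + 1) → ℝ), (∀ q, 0 ≤ w q ∧ w q ≤ 1) ∧
      (∀ (n : ℕ) (A : L.Structure (Fin n)) (c : Fin (K + 1) → Fin n),
        G.probStructure n A ≠ 0 → MatchesEq e c → 0 < w (atomicType A c)) ∧
      (∀ (n : ℕ) (a : Fin K → Fin n),
        (Finset.univ.filter fun b => MatchesEq e (Fin.snoc a b : Fin (K + 1) → Fin n)).card ≤
          n ^ d ∧
        (MatchesEq (e.comap Fin.castSucc) a → (n - K) ^ d ≤
          (Finset.univ.filter fun b => MatchesEq e (Fin.snoc a b : Fin (K + 1) → Fin n)).card)) ∧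
      ∀ δ : ℝ, 0 < δ → G.WHP fun n A => ∀ (a : Fin K → Fin n) (q : AtomicType L (K + 1)),
        (q.2 = fun i j => e.r i j) →
        |((Finset.univ.filter fun b =>
            atomicType A (Fin.snoc a b : Fin (K + 1) → Fin n) = q).card : ℝ) / (n : ℝ) ^ d -
          if atomicType A a = q.comap Fin.castSucc then w q else 0| ≤ δ := by
  have hsc : ∀ {n : ℕ} (a : Fin K → Fin n) (x : Fin n),
      (Fin.snoc a x : Fin (K + 1) → Fin n) ∘ Fin.castSucc = a := fun a x => by ext i; simp
  by_cases he : ∃ i : Fin K, e.r i.castSucc (Fin.last K)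
  · obtain ⟨i, hi⟩ := he
    set s : Fin (K + 1) → Fin K := Fin.snoc id i with hs
    have hsnoc : ∀ {n : ℕ} (a : Fin K → Fin n),
        (Fin.snoc a (a i) : Fin (K + 1) → Fin n) = a ∘ s := fun a => by
      ext j
      induction j using Fin.lastCases <;> simp [hs]
    have huniq : ∀ {n : ℕ} (a : Fin K → Fin n) (x : Fin n),
        MatchesEq e (Fin.snoc a x : Fin (K + 1) → Fin n) → x = a i := fun a x h => by
      have := (h _ _).1 hi
      simpa using this.symm
    refine ⟨0, fun q => if q = (q.comap Fin.castSucc).comap s then 1 else 0, fun q => ?_,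
      fun n A c _ hc => ?_, fun n a => ⟨?_, fun ha => ?_⟩, fun δ hδ => ?_⟩
    · dsimp only
      split_ifs <;> norm_num
    · have : c = (c ∘ Fin.castSucc) ∘ s := by
        rw [← hsnoc]
        ext j
        induction j using Fin.lastCases with
        | last => simp [(hc _ _).1 hi]
        | cast j => simp
      dsimp only
      rw [if_pos]
      · exact one_pos
      · rw [← atomicType_comp, ← atomicType_comp, ← this]
    · rw [pow_zero, Finset.card_le_one]
      intro x hx y hy
      rw [Finset.mem_filter] at hx hy
      rw [huniq a x hx.2, huniq a y hy.2]
    · rw [pow_zero, Finset.one_le_card]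
      refine ⟨a i, Finset.mem_filter.2 ⟨Finset.mem_univ _, matchesEq_iff_castSucc.2 ⟨?_, ?_⟩⟩⟩
      · rwa [hsc]
      · intro j
        simp only [Fin.snoc_castSucc, Fin.snoc_last]
        rw [← ha j i]
        exact ⟨fun h => e.trans h (e.symm hi), fun h => e.trans h hi⟩
    · refine PLANetwork.whp_of_eventually (Eventually.of_forall fun n A _ a q hq => ?_)
      have hfil : ∀ x, atomicType A (Fin.snoc a x : Fin (K + 1) → Fin n) = q ↔
          x = a i ∧ atomicType A a = q.comap Fin.castSucc ∧
            q = (q.comap Fin.castSucc).comap s := by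
        intro x
        constructor
        · intro h
          have hx : x = a i := huniq a x ((matchesEq_iff (A := A)).2 (h ▸ hq))
          have ha : atomicType A a = q.comap Fin.castSucc := by
            rw [← h, ← atomicType_comp, hsc]
          refine ⟨hx, ha, ?_⟩
          rw [← ha, ← atomicType_comp, ← hsnoc, ← hx, h]
        · rintro ⟨rfl, h₁, h₂⟩
          rw [hsnoc, atomicType_comp, h₁, ← h₂]
      simp only [hfil, pow_zero, div_one]
      by_cases h₁ : atomicType A a = q.comap Fin.castSucc
      · by_cases h₂ : q = (q.comap Fin.castSucc).comap s
        · rw [if_pos h₁, if_pos h₂]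
          have : (Finset.univ.filter fun x => x = a i ∧ atomicType A a = q.comap Fin.castSucc ∧
              q = (q.comap Fin.castSucc).comap s) = {a i} := by
            ext x; simp only [Finset.mem_filter, Finset.mem_univ, Finset.mem_singleton]; tauto
          rw [this]
          simpa using hδ.le
        · rw [if_pos h₁, if_neg h₂, Finset.filter_false_of_mem (by tauto)]
          simpa using hδ.le
      · rw [if_neg h₁, Finset.filter_false_of_mem (by tauto)]
        simpa using hδ.le
  · push Not at he
    have hfresh : ∀ {n : ℕ} (a : Fin K → Fin n) (x : Fin n),
        MatchesEq e (Fin.snoc a x : Fin (K + 1) → Fin n) → ∀ i, a i ≠ x := by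
      intro n a x h i hix
      have h2 := (h i.castSucc (Fin.last K)).2
      simp only [Fin.snoc_castSucc, Fin.snoc_last] at h2
      exact he i (h2 hix)
    refine ⟨1, G.freshWeight, fun q => ⟨G.freshWeight_nonneg q, G.freshWeight_le_one q⟩,
      fun n A c hA hc => G.freshWeight_pos hG hA fun i h => he i ((hc _ _).2 h),
      fun n a => ⟨?_, fun ha => ?_⟩, fun δ hδ => ?_⟩
    · simpa using Finset.card_le_univ (Finset.univ.filter fun b =>
        MatchesEq e (Fin.snoc a b : Fin (K + 1) → Fin n))
    · have h1 := le_card_fresh_add a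
      have h2 : (Finset.univ.filter fun b => ∀ i, a i ≠ b) ⊆ Finset.univ.filter fun b =>
          MatchesEq e (Fin.snoc a b : Fin (K + 1) → Fin n) := by
        intro x hx
        rw [Finset.mem_filter] at hx ⊢
        refine ⟨hx.1, matchesEq_iff_castSucc.2 ⟨?_, fun i => iff_of_false (he i) ?_⟩⟩
        · rwa [hsc]
        · simpa using hx.2 i
      have h3 := Finset.card_le_card h2
      rw [pow_one]
      omega
    · refine (G.whp_fresh_saturated hG K hδ).mono (Eventually.of_forall fun n A _ h a q hq => ?_)
      have := h a q
      rw [pow_one]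
      convert this using 6
      ext x
      simp only [Finset.mem_filter, Finset.mem_univ, true_and]
      exact ⟨fun h => ⟨hfresh a x ((matchesEq_iff (A := A)).2 (h ▸ hq)), h⟩, fun h => h.2⟩

/-- Exponents add and weights multiply as variables are appended, so `d` is the number of classes of
`e` that contain none of the first `p` positions. The cardinality bounds show that the number of
matching tuples is `n ^ d` up to a factor tending to `1`. -/
theorem exists_append_weight (hG : ∀ R, (G.θ R).AggFree) {p l : ℕ} (e : Setoid (Fin (p + l))) :
    ∃ (d : ℕ) (w : AtomicType L (p + l) → ℝ), (∀ q, 0 ≤ w q ∧ w q ≤ 1) ∧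
      (∀ (n : ℕ) (A : L.Structure (Fin n)) (c : Fin (p + l) → Fin n),
        G.probStructure n A ≠ 0 → MatchesEq e c → 0 < w (atomicType A c)) ∧
      (∀ (n : ℕ) (a : Fin p → Fin n),
        (Finset.univ.filter fun b : Fin l → Fin n => MatchesEq e (Fin.append a b)).card ≤ n ^ d ∧
        (MatchesEq (e.comap (Fin.castAdd l)) a → (n - (p + l)) ^ d ≤
          (Finset.univ.filter fun b : Fin l → Fin n => MatchesEq e (Fin.append a b)).card)) ∧
      ∀ δ : ℝ, 0 < δ → G.WHP fun n A => ∀ (a : Fin p → Fin n) (q : AtomicType L (p + l)),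
        (q.2 = fun i j => e.r i j) →
        |((Finset.univ.filter fun b : Fin l → Fin n =>
            atomicType A (Fin.append a b) = q).card : ℝ) / (n : ℝ) ^ d -
          if atomicType A a = q.comap (Fin.castAdd l) then w q else 0| ≤ δ := by
  induction l with
  | zero =>
    have happ : ∀ {n : ℕ} (a : Fin p → Fin n) (b : Fin 0 → Fin n), Fin.append a b = a :=
      fun a b => by
        rw [Fin.append_right_nil a b rfl]; rfl
    have hcast : ∀ q : AtomicType L (p + 0), q.comap (Fin.castAdd 0) = q := fun q => rfl
    refine ⟨0, fun _ => 1, fun _ => ⟨zero_le_one, le_rfl⟩, fun _ _ _ _ _ => one_pos,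
      fun n a => ⟨?_, fun ha => ?_⟩, fun δ hδ => ?_⟩
    · simpa using Finset.card_le_univ (Finset.univ.filter fun b : Fin 0 → Fin n =>
        MatchesEq e (Fin.append a b))
    · rw [pow_zero, Finset.one_le_card]
      exact ⟨Fin.elim0, Finset.mem_filter.2 ⟨Finset.mem_univ _, by rw [happ]; exact ha⟩⟩
    · refine PLANetwork.whp_of_eventually (Eventually.of_forall fun n A _ a q _ => ?_)
      simp only [happ, hcast]
      split_ifs with h
      · simpa [h] using hδ.le
      · simpa [h] using hδ.le
  | succ l ih =>
    set e' : Setoid (Fin (p + l)) := e.comap Fin.castSucc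
    obtain ⟨d', w', hw', hpos', hcard', hlim'⟩ := ih e'
    obtain ⟨d₁, w₁, hw₁, hpos₁, hcard₁, hlim₁⟩ := exists_snoc_weight hG (K := p + l) e
    have happ : ∀ {n : ℕ} (a : Fin p → Fin n) (b : Fin l → Fin n) (x : Fin n),
        Fin.append a (Fin.snoc b x : Fin (l + 1) → Fin n) = Fin.snoc (Fin.append a b) x :=
      fun a b x => Fin.append_snoc a b x
    have hsc : ∀ {n : ℕ} (a : Fin (p + l) → Fin n) (x : Fin n),
        (Fin.snoc a x : Fin (p + l + 1) → Fin n) ∘ Fin.castSucc = a := fun a x => by ext i; simp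
    have hsum : ∀ (n : ℕ) (a : Fin p → Fin n) (P : (Fin (p + (l + 1)) → Fin n) → Prop)
        (P' : (Fin (p + l) → Fin n) → Prop), (∀ (c : Fin (p + l) → Fin n) (x : Fin n), P (Fin.snoc c x : Fin (p + l + 1) → Fin n) → P' c) →
        (Finset.univ.filter fun b : Fin (l + 1) → Fin n => P (Fin.append a b)).card =
        ∑ b ∈ Finset.univ.filter fun b : Fin l → Fin n => P' (Fin.append a b),
          (Finset.univ.filter fun x =>
            P (Fin.snoc (Fin.append a b) x : Fin (p + l + 1) → Fin n)).card := by
      intro n a P P' hP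
      rw [card_filter_snoc, Finset.sum_filter]
      refine Finset.sum_congr rfl fun b _ => ?_
      simp only [happ]
      split_ifs with h
      · rfl
      · rw [Finset.card_eq_zero]
        exact Finset.filter_false_of_mem fun x _ hx => h (hP _ _ hx)
    have hM := fun n a => hsum n a (MatchesEq e) (MatchesEq e') fun c x hx => by
      have := hx.comp Fin.castSucc
      rwa [hsc] at this
    refine ⟨d' + d₁, fun q => w' (q.comap Fin.castSucc) * w₁ q,
      fun q => ⟨mul_nonneg (hw' _).1 (hw₁ _).1, mul_le_one₀ (hw' _).2 (hw₁ _).1 (hw₁ _).2⟩,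
      fun n A c hA hc => mul_pos (hpos' n A (c ∘ Fin.castSucc) hA (hc.comp _)) (hpos₁ n A c hA hc),
      fun n a => ⟨?_, fun ha => ?_⟩, fun δ hδ => ?_⟩
    · refine (hM n a).trans_le ?_
      refine (Finset.sum_le_card_nsmul _ _ _ fun b _ => (hcard₁ n _).1).trans ?_
      rw [smul_eq_mul, pow_add]
      exact Nat.mul_le_mul_right _ (hcard' n a).1
    · refine le_trans ?_ (hM n a).ge
      refine le_trans ?_ (Finset.card_nsmul_le_sum _ _ ((n - (p + l)) ^ d₁) fun b hb =>
        (hcard₁ n _).2 (Finset.mem_filter.1 hb).2)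
      rw [smul_eq_mul, pow_add]
      refine Nat.mul_le_mul ((Nat.pow_le_pow_left (by omega) _).trans ((hcard' n a).2 ?_))
        (Nat.pow_le_pow_left (by omega) _)
      exact ha
    · refine ((hlim' (δ / 2) (by linarith)).and (hlim₁ (δ / 2) (by linarith))).mono ?_
      filter_upwards [eventually_gt_atTop 0] with n hn A _ ⟨h', h₁⟩ a q hq
      have hq' : (q.comap Fin.castSucc).2 = fun i j => e'.r i j :=
        congrArg (fun f i j => f (Fin.castSucc i) (Fin.castSucc j)) hq
      specialize h' a (q.comap Fin.castSucc) hq'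
      have hcc : (q.comap Fin.castSucc).comap (Fin.castAdd l) = q.comap (Fin.castAdd (l + 1)) :=
        rfl
      rw [hcc] at h'
      set S := Finset.univ.filter fun b : Fin l → Fin n =>
        atomicType A (Fin.append a b) = q.comap Fin.castSucc with hS
      have hcount : ((Finset.univ.filter fun b : Fin (l + 1) → Fin n =>
          atomicType A (Fin.append a b) = q).card : ℝ) = ∑ b ∈ S, ((Finset.univ.filter fun x =>
          atomicType A (Fin.snoc (Fin.append a b) x : Fin (p + l + 1) → Fin n) = q).card : ℝ) := by
        rw [← Nat.cast_sum, hS]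
        have := hsum n a (fun c => atomicType A c = q)
          (fun c => atomicType A c = q.comap Fin.castSucc) fun c x hx => by
            rw [← hx]
            exact (congrArg (atomicType A) (hsc c x)).symm
        congr 1
        convert this
      have hSle : (S.card : ℝ) ≤ (n : ℝ) ^ d' := by
        rw [← Nat.cast_pow]
        refine Nat.cast_le.2 (le_trans (Finset.card_le_card fun b hb => ?_)
          (hcard' n a).1)
        rw [Finset.mem_filter] at hb ⊢
        exact ⟨hb.1, (matchesEq_iff (A := A)).2 (hb.2 ▸ hq')⟩
      have hn0 : (0 : ℝ) < n := by exact_mod_cast hn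
      have hnd' : (0 : ℝ) < (n : ℝ) ^ d' := by positivity
      have hterm : ∀ b ∈ S, |((Finset.univ.filter fun x => atomicType A
          (Fin.snoc (Fin.append a b) x : Fin (p + l + 1) → Fin n) = q).card : ℝ) /
            (n : ℝ) ^ d₁ - w₁ q| ≤ δ / 2 := fun b hb => by
        have := h₁ (Fin.append a b) q hq
        rwa [if_pos (Finset.mem_filter.1 hb).2] at this
      -- One half of the error comes from the last variable, averaged over `S`; the other half, in
      -- `hB`, from the size of `S`.
      have hA : |((Finset.univ.filter fun b : Fin (l + 1) → Fin n =>
            atomicType A (Fin.append a b) = q).card : ℝ) / (n : ℝ) ^ (d' + d₁) -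
          (S.card : ℝ) / (n : ℝ) ^ d' * w₁ q| ≤ δ / 2 := by
        have : ((Finset.univ.filter fun b : Fin (l + 1) → Fin n =>
            atomicType A (Fin.append a b) = q).card : ℝ) / (n : ℝ) ^ (d' + d₁) -
          (S.card : ℝ) / (n : ℝ) ^ d' * w₁ q =
          (∑ b ∈ S, (((Finset.univ.filter fun x => atomicType A
          (Fin.snoc (Fin.append a b) x : Fin (p + l + 1) → Fin n) = q).card : ℝ) /
            (n : ℝ) ^ d₁ - w₁ q)) / (n : ℝ) ^ d' := by
          rw [Finset.sum_sub_distrib, ← Finset.sum_div, Finset.sum_const, nsmul_eq_mul, pow_add,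
            hcount]
          field_simp
        rw [this, abs_div, abs_of_pos hnd', div_le_iff₀ hnd']
        refine (Finset.abs_sum_le_sum_abs _ _).trans ((Finset.sum_le_card_nsmul _ _ _ hterm).trans ?_)
        rw [nsmul_eq_mul, mul_comm]
        exact mul_le_mul_of_nonneg_left hSle (by linarith)
      have hB : |(S.card : ℝ) / (n : ℝ) ^ d' * w₁ q -
          if atomicType A a = q.comap (Fin.castAdd (l + 1)) then
            w' (q.comap Fin.castSucc) * w₁ q else 0| ≤ δ / 2 := by
        have : (S.card : ℝ) / (n : ℝ) ^ d' * w₁ q -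
          (if atomicType A a = q.comap (Fin.castAdd (l + 1)) then
            w' (q.comap Fin.castSucc) * w₁ q else 0) = ((S.card : ℝ) / (n : ℝ) ^ d' -
          (if atomicType A a = q.comap (Fin.castAdd (l + 1)) then
            w' (q.comap Fin.castSucc) else 0)) * w₁ q := by
          split_ifs <;> ring
        rw [this, abs_mul, abs_of_nonneg (hw₁ q).1]
        exact (mul_le_of_le_one_right (abs_nonneg _) (hw₁ q).2).trans h'
      refine (abs_sub_le _ ((S.card : ℝ) / (n : ℝ) ^ d' * w₁ q) _).trans ?_
      linarith

end Saturation

/-! ### Limits of admissible aggregation functions on sampled sequences -/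

section AggregationLimits

open scoped Classical

/-- The `k` sequences `R` of length `M` are `δ`-close to the sequences obtained from a sequence `s`
in `T` with frequencies `w` by applying the functions `g i`. -/
def NearSampled {k : ℕ} {T : Type*} (w : T → ℝ) (g : Fin k → T → unitInterval) (δ : ℝ) (M : ℕ+)
    (R : Fin k → UnitSeq) : Prop :=
  ∃ (r : Fin k → Fin M → unitInterval) (s : Fin M → T), R = (fun i => ⟨M, r i⟩) ∧
    (∀ i j, |(r i j : ℝ) - g i (s j)| ≤ δ) ∧
    ∀ q, |((Finset.univ.filter fun j => s j = q).card : ℝ) / (M : ℕ) - w q| ≤ δ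

variable {k : ℕ} {T : Type*} [Fintype T]

/-- The values of `g`. -/
def sampleParam (g : T → unitInterval) (j : Fin (Finset.univ.image g).card) : unitInterval :=
  (Finset.univ.image g).equivFin.symm j

/-- The frequencies of the values of `g`, for elements of `T` sampled with frequencies `w`. -/
def sampleFreq (w : T → ℝ) (g : T → unitInterval) (j : Fin (Finset.univ.image g).card) :
    unitInterval :=
  Set.projIcc 0 1 zero_le_one (∑ q ∈ Finset.univ.filter fun q => g q = sampleParam g j, w q)

theorem sampleParam_injective (g : T → unitInterval) : Function.Injective (sampleParam g) :=
  Subtype.val_injective.comp (Finset.univ.image g).equivFin.symm.injective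

theorem exists_sampleParam_eq (g : T → unitInterval) (q : T) : ∃ j, sampleParam g j = g q :=
  ⟨(Finset.univ.image g).equivFin ⟨g q, Finset.mem_image_of_mem g (Finset.mem_univ q)⟩, by
    simp [sampleParam]⟩

theorem exists_eq_sampleParam (g : T → unitInterval) (j : Fin (Finset.univ.image g).card) :
    ∃ q, g q = sampleParam g j := by
  obtain ⟨q, _, hq⟩ := Finset.mem_image.1 ((Finset.univ.image g).equivFin.symm j).2
  exact ⟨q, hq⟩

theorem sampleFreq_pos {w : T → ℝ} (hw : ∀ q, 0 < w q) (g : T → unitInterval)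
    (j : Fin (Finset.univ.image g).card) : 0 < sampleFreq w g j := by
  obtain ⟨q, hq⟩ := exists_eq_sampleParam g j
  have : 0 < ∑ q ∈ Finset.univ.filter fun q => g q = sampleParam g j, w q :=
    Finset.sum_pos (fun q _ => hw q) ⟨q, by simp [hq]⟩
  rw [← Subtype.coe_lt_coe, sampleFreq, Set.coe_projIcc]
  exact lt_max_of_lt_right (lt_min one_pos this)

/-- Once the error is small, each entry lies in the interval around the value of its label. Labels
with the same value share an interval, so their frequencies add up. -/
theorem convergenceTesting_of_nearSampled {w : T → ℝ} {g : Fin k → T → unitInterval} {δ : ℕ → ℝ}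
    (hδ : Tendsto δ atTop (𝓝 0)) {M : ℕ → ℕ+} (hM : StrictMono M) {R : ℕ → Fin k → UnitSeq}
    (hR : ∀ n, NearSampled w g (δ n) (M n) (R n)) (i : Fin k) :
    ConvergenceTesting (fun n => R n i) (sampleParam (g i)) (sampleFreq w (g i)) := by
  choose r s hr hclose hfreq using hR
  obtain rfl : R = fun n i => ⟨M n, r n i⟩ := funext hr
  refine ⟨fun n => hM n.lt_succ_self, fun J hJ hdisj => ?_⟩
  choose idx hidx using exists_sampleParam_eq (g i)
  have hev : ∀ᶠ n in atTop, ∀ q, ∀ x : unitInterval, |(x : ℝ) - g i q| ≤ δ n → x ∈ J (idx q) := by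
    refine eventually_all.2 fun q => ?_
    have hmem : J (idx q) ∈ 𝓝 (g i q) := by
      rw [← hidx q]
      exact (hJ (idx q)).1.mem_nhds (hJ (idx q)).2.2
    obtain ⟨η, hη, hsub⟩ := Metric.mem_nhds_iff.1 hmem
    filter_upwards [hδ.eventually_lt_const hη] with n hn x hx
    refine hsub ?_
    rw [Metric.mem_ball, Subtype.dist_eq, Real.dist_eq]
    exact hx.trans_lt hn
  obtain ⟨N, hN⟩ := eventually_atTop.1 hev
  have hin : ∀ n ≥ N, ∀ j, r n i j ∈ J (idx (s n j)) := fun n hn j =>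
    hN n hn _ _ (hclose n i j)
  refine ⟨⟨N, fun n hn j => Set.mem_iUnion.2 ⟨_, hin n hn j⟩⟩, fun j => ?_⟩
  have hidx' : ∀ q, idx q = j ↔ g i q = sampleParam (g i) j := fun q => by
    rw [← hidx q, (sampleParam_injective (g i)).eq_iff]
  set S := Finset.univ.filter fun q => g i q = sampleParam (g i) j with hS
  have hcard : ∀ n ≥ N, (Nat.card {a // r n i a ∈ J j} : ℝ) / (M n : ℕ) =
      ∑ q ∈ S, ((Finset.univ.filter fun a => s n a = q).card : ℝ) / (M n : ℕ) := by
    intro n hn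
    rw [← Finset.sum_div, ← Nat.cast_sum]
    congr 2
    have hiff : ∀ a, r n i a ∈ J j ↔ s n a ∈ S := fun a => by
      rw [hS, Finset.mem_filter, ← hidx']
      refine ⟨fun h => ⟨Finset.mem_univ _, ?_⟩, fun h => h.2 ▸ hin n hn a⟩
      by_contra hne
      exact Set.disjoint_left.1 (hdisj _ _ hne) (hin n hn a) h
    rw [Nat.card_eq_fintype_card, Fintype.card_subtype]
    rw [Finset.card_eq_sum_card_fiberwise (f := s n) (t := S)]
    · refine Finset.sum_congr rfl fun q hq => ?_
      congr 1
      ext a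
      simp only [Finset.mem_filter, Finset.mem_univ, true_and, hiff]
      exact ⟨fun h => h.2, fun h => ⟨h ▸ hq, h⟩⟩
    · intro a ha
      simpa [hiff] using ha
  have hlim : Tendsto (fun n => (Nat.card {a // r n i a ∈ J j} : ℝ) / (M n : ℕ)) atTop
      (𝓝 (∑ q ∈ S, w q)) := by
    have h1 : Tendsto (fun n => ∑ q ∈ S, ((Finset.univ.filter fun a => s n a = q).card : ℝ) /
        (M n : ℕ)) atTop (𝓝 (∑ q ∈ S, w q)) := by
      refine tendsto_finsetSum _ fun q _ => ?_
      refine tendsto_iff_dist_tendsto_zero.2 (squeeze_zero (fun _ => dist_nonneg) (fun n => ?_) hδ)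
      rw [Real.dist_eq]
      exact hfreq n q
    exact h1.congr' (eventually_atTop.2 ⟨N, fun n hn => (hcard n hn).symm⟩)
  -- The weights are not assumed to sum to `1`; as limits of proportions these sums lie in `[0, 1]`,
  -- so the projection in `sampleFreq` changes nothing.
  have hmem : ∑ q ∈ S, w q ∈ Set.Icc (0 : ℝ) 1 := by
    refine isClosed_Icc.mem_of_tendsto hlim (Eventually.of_forall fun n => ⟨by positivity, ?_⟩)
    refine div_le_one_of_le₀ ?_ (Nat.cast_nonneg _)
    rw [Nat.card_eq_fintype_card]
    exact_mod_cast (Fintype.card_subtype_le _).trans_eq (Fintype.card_fin _)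
  have : (sampleFreq w (g i) j : ℝ) = ∑ q ∈ S, w q := by
    rw [sampleFreq, ← hS, Set.projIcc_of_mem _ hmem]
  rw [this]
  exact hlim

/-- An admissible aggregation function tends to a limit on long sequences which are sampled with
given positive frequencies. -/
theorem AggFun.Admissible.exists_limit {F : AggFun k} (hF : F.Admissible) {w : T → ℝ}
    (hw : ∀ q, 0 < w q) (g : Fin k → T → unitInterval) :
    ∃ y : unitInterval, ∀ ε : ℝ, 0 < ε → ∃ δ : ℝ, 0 < δ ∧ ∃ N : ℕ, ∀ (M : ℕ+) (R : Fin k → UnitSeq),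
      N ≤ M → NearSampled w g δ M R → |(F.toFun R : ℝ) - y| ≤ ε := by
  have hseq : ∀ y : unitInterval, (¬ ∀ ε : ℝ, 0 < ε → ∃ δ : ℝ, 0 < δ ∧ ∃ N : ℕ, ∀ (M : ℕ+)
      (R : Fin k → UnitSeq), N ≤ M → NearSampled w g δ M R → |(F.toFun R : ℝ) - y| ≤ ε) →
      ∃ (ε : ℝ) (R : ℕ → Fin k → UnitSeq), 0 < ε ∧ Nonempty T ∧
        (∀ i, ConvergenceTesting (fun n => R n i) (sampleParam (g i)) (sampleFreq w (g i))) ∧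
        ∀ n, ε < |(F.toFun (R n) : ℝ) - y| := by
    intro y hy
    push Not at hy
    obtain ⟨ε, hε, hy⟩ := hy
    choose M R hMn hnear hbad using fun n : ℕ => hy (1 / ((n : ℝ) + 1)) (by positivity) n
    have hMt : Tendsto M atTop atTop := by
      refine tendsto_atTop_atTop.2 fun b => ⟨b, fun n hn => ?_⟩
      rw [← PNat.coe_le_coe]
      exact hn.trans (hMn n)
    -- Convergence testing demands strictly increasing lengths.
    obtain ⟨φ, hφ, hMφ⟩ := strictMono_subseq_of_tendsto_atTop hMt
    refine ⟨ε, R ∘ φ, hε, ?_, convergenceTesting_of_nearSampled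
      (tendsto_one_div_add_atTop_nhds_zero_nat.comp hφ.tendsto_atTop) hMφ fun n => hnear _,
      fun n => hbad _⟩
    obtain ⟨_, s, _⟩ := hnear 0
    exact ⟨s ⟨0, (M 0).pos⟩⟩
  by_contra hcon
  push Not at hcon
  -- The candidate `0` serves only to produce some testing sequence `ρ`. A limit point `y` of `F`
  -- along `ρ` is then the real candidate, and admissibility compares `ρ` with the sequence refuting
  -- `y`.
  obtain ⟨_, ρ, _, ⟨q⟩, hρ, _⟩ := hseq 0 (by push Not; exact hcon 0)
  obtain ⟨y, φ, hφ, hy⟩ := CompactSpace.tendsto_subseq fun n => F.toFun (ρ n)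
  obtain ⟨ε, R, hε, _, hR, hbad⟩ := hseq y (by push Not; exact hcon y)
  have hρφ : ∀ i, ConvergenceTesting (fun n => ρ (φ n) i) (sampleParam (g i))
      (sampleFreq w (g i)) := fun i => by
    obtain ⟨h₁, h₂⟩ := hρ i
    refine ⟨fun n => strictMono_nat_of_lt_succ h₁ (hφ n.lt_succ_self), fun J hJ hd => ?_⟩
    obtain ⟨⟨N, hN⟩, hlim⟩ := h₂ J hJ hd
    exact ⟨⟨N, fun n hn => hN _ (hn.trans (hφ.id_le n))⟩,
      fun j => (hlim j).comp hφ.tendsto_atTop⟩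
  have hdiff := hF.2 (fun i => (Finset.univ.image (g i)).card) (fun i => sampleParam (g i))
    (fun i => sampleFreq w (g i)) R (fun n => ρ (φ n))
    (fun i => Finset.card_pos.2 ⟨g i q, Finset.mem_image_of_mem _ (Finset.mem_univ q)⟩)
    (fun i => sampleParam_injective _) (fun i => sampleFreq_pos hw _) hR hρφ
  have hy' : Tendsto (fun n => |(F.toFun (ρ (φ n)) : ℝ) - y|) atTop (𝓝 0) := by
    have := tendsto_iff_dist_tendsto_zero.1 hy
    simpa [Subtype.dist_eq, Real.dist_eq] using this
  have hsum := hdiff.add hy'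
  rw [add_zero] at hsum
  obtain ⟨n, hn⟩ := (hsum.eventually_lt_const hε).exists
  exact absurd ((abs_sub_le _ _ _).trans_lt hn) (hbad n).not_gt

/-- The counterpart of `AggFun.Admissible.exists_limit` for sequences of length `1`. -/
theorem AggFun.Admissible.exists_limit_one {F : AggFun k} (hF : F.Admissible) (w : T → ℝ)
    (g : Fin k → T → unitInterval) :
    ∃ y : unitInterval, ∀ ε : ℝ, 0 < ε → ∃ δ : ℝ, 0 < δ ∧ ∀ R : Fin k → UnitSeq,
      NearSampled w g δ 1 R → |(F.toFun R : ℝ) - y| ≤ ε := by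
  have : Subsingleton (Fin ((1 : ℕ+) : ℕ)) := inferInstanceAs (Subsingleton (Fin 1))
  -- In a sequence of length `1` the frequencies are `0` or `1`, so with error at most `1 / 4` the
  -- sampled label is one of weight at least `3 / 4`, and no other label can have such a weight.
  -- Without such a label there is nothing to approximate.
  by_cases h : ∃ q, 3 / 4 ≤ w q
  swap
  · refine ⟨0, fun ε _ => ⟨1 / 4, by norm_num, fun R ⟨r, s, _, _, hs⟩ => absurd ?_ h⟩⟩
    refine ⟨s 0, ?_⟩
    have := hs (s 0)
    have h1 : (Finset.univ.filter fun j => s j = s 0) = Finset.univ :=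
      Finset.filter_true_of_mem fun j _ => congrArg s (Subsingleton.elim j 0)
    rw [h1] at this
    norm_num [abs_le] at this
    linarith
  obtain ⟨q, hq⟩ := h
  refine ⟨F.toFun fun i => ⟨1, fun _ => g i q⟩, fun ε hε => ?_⟩
  obtain ⟨η, hη, hcont⟩ := Metric.continuous_iff.1 (hF.1 fun _ => 1) (fun i _ => g i q) ε hε
  refine ⟨min (1 / 4) (η / 2), lt_min (by norm_num) (by linarith), ?_⟩
  rintro R ⟨r, s, rfl, hr, hs⟩
  have hsq : ∀ j, s j = q := by
    intro j
    by_contra hne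
    have h1 : (Finset.univ.filter fun j => s j = q) = ∅ :=
      Finset.filter_false_of_mem fun j' _ => by rwa [Subsingleton.elim j' j]
    have := (hs q).trans (min_le_left _ _)
    rw [h1] at this
    norm_num [abs_le] at this
    linarith
  have := hcont r ((dist_pi_lt_iff hη).2 fun i => (dist_pi_lt_iff hη).2 fun j => by
    have := (hr i j).trans (min_le_right _ _)
    rw [Subtype.dist_eq, Real.dist_eq, ← hsq j]
    linarith)
  rw [Subtype.dist_eq, Real.dist_eq] at this
  exact this.le

end AggregationLimits

/-! ### Elimination of aggregations and basic probability formulas -/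

section Elimination

open scoped Classical

variable {L : FirstOrder.Language.{u, v}}

theorem PLA.le_value_listConj {m : ℕ} {D : Type*} [Finite D] (A : L.Structure D) (a : Fin m → D)
    (c : unitInterval) (l : List (PLA L m)) :
    c ≤ (PLA.listConj l).value A a ↔ ∀ χ ∈ l, c ≤ χ.value A a := by
  induction l with
  | nil => simpa [PLA.listConj, PLA.value] using unitInterval.le_one'
  | cons φ l ih =>
    cases l with
    | nil => simp [PLA.listConj]
    | cons χ l =>
      rw [PLA.listConj, PLA.value, le_min_iff, ih]
      simp

variable [Fintype (RelSymb L)]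

/-- The literals that make up the atomic type `q`. -/
def AtomicType.literals {m : ℕ} (q : AtomicType L m) : List (PLA L m) :=
  ((Finset.univ : Finset (Atom L (Fin m))).toList.map fun v =>
    if q.1 v then .rel v.1 v.2 else .neg (.rel v.1 v.2)) ++
  ((Finset.univ : Finset (Fin m × Fin m)).toList.map fun p =>
    if q.2 p.1 p.2 then .eq p.1 p.2 else .neg (.eq p.1 p.2))

theorem AtomicType.isLiteral_of_mem_literals {m : ℕ} {q : AtomicType L m} {χ : PLA L m}
    (hχ : χ ∈ q.literals) : χ.IsLiteral := by
  simp only [AtomicType.literals, List.mem_append, List.mem_map] at hχ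
  rcases hχ with ⟨v, _, rfl⟩ | ⟨p, _, rfl⟩
  · split_ifs
    · exact Or.inl (Or.inr ⟨_, _, rfl⟩)
    · exact Or.inr ⟨_, Or.inr ⟨_, _, rfl⟩, rfl⟩
  · split_ifs
    · exact Or.inl (Or.inl ⟨_, _, rfl⟩)
    · exact Or.inr ⟨_, Or.inl ⟨_, _, rfl⟩, rfl⟩

theorem AtomicType.value_listConj_literals {m : ℕ} {D : Type*} [Finite D] (A : L.Structure D)
    (a : Fin m → D) (q : AtomicType L m) :
    (PLA.listConj q.literals).value A a = if atomicType A a = q then 1 else 0 := by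
  have hrel : ∀ v : Atom L (Fin m), PLA.value A
      (if q.1 v then PLA.rel v.1 v.2 else .neg (.rel v.1 v.2)) a =
      if ((atomicType A a).1 v ↔ q.1 v) then 1 else 0 := fun v => by
    have : A.RelMap v.1.2 (fun i => a (v.2 i)) ↔ (atomicType A a).1 v := Iff.rfl
    by_cases h₁ : q.1 v <;> by_cases h₂ : (atomicType A a).1 v <;> simp [PLA.value, h₁, h₂, this]
  have heq : ∀ p : Fin m × Fin m, PLA.value A
      (if q.2 p.1 p.2 then PLA.eq p.1 p.2 else .neg (.eq p.1 p.2)) a =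
      if ((atomicType A a).2 p.1 p.2 ↔ q.2 p.1 p.2) then 1 else 0 := fun p => by
    have : a p.1 = a p.2 ↔ (atomicType A a).2 p.1 p.2 := Iff.rfl
    by_cases h₁ : q.2 p.1 p.2 <;> by_cases h₂ : (atomicType A a).2 p.1 p.2 <;>
      simp [PLA.value, h₁, h₂, this]
  have hc : ∀ c : unitInterval, c ≤ (PLA.listConj q.literals).value A a ↔
      (∀ v, c ≤ if ((atomicType A a).1 v ↔ q.1 v) then 1 else 0) ∧
      ∀ p : Fin m × Fin m, c ≤ if ((atomicType A a).2 p.1 p.2 ↔ q.2 p.1 p.2) then 1 else 0 := by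
    intro c
    simp only [PLA.le_value_listConj, AtomicType.literals, List.mem_append, List.mem_map,
      Finset.mem_toList, Finset.mem_univ, true_and, or_imp, forall_and, forall_exists_index,
      forall_apply_eq_imp_iff, hrel, heq]
  split_ifs with h
  · refine le_antisymm unitInterval.le_one' ((hc 1).2 ⟨fun v => ?_, fun p => ?_⟩) <;> simp [h]
  · refine le_antisymm ?_ unitInterval.nonneg'
    by_contra hpos
    obtain ⟨h₁, h₂⟩ := (hc _).1 le_rfl
    refine h (Prod.ext (funext fun v => ?_) (funext fun i => funext fun j => ?_))
    · by_contra hne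
      have := h₁ v
      rw [if_neg fun h' => hne (propext h')] at this
      exact hpos this
    · by_contra hne
      have := h₂ (i, j)
      rw [if_neg fun h' => hne (propext h')] at this
      exact hpos this

/-- Take the conjunction of `q → f q` over all types `q`: the implications whose type is not
realized have a false antecedent and value `1`, and the remaining one has value `f q`. Inconsistent
types do no harm. -/
theorem exists_isBasicProbability_value {m : ℕ} (f : AtomicType L m → unitInterval) :
    ∃ ψ : PLA L m, ψ.IsBasicProbability ∧ ∀ (n : ℕ) (A : L.Structure (Fin n)) (a : Fin m → Fin n),
      ψ.value A a = f (atomicType A a) := by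
  have := Fintype.ofFinite (AtomicType L m)
  refine ⟨PLA.listConj (((Finset.univ : Finset (AtomicType L m)).toList.map
    fun q => (q.literals, f q)).map fun q => .imp (PLA.listConj q.1) (.const q.2)),
    ⟨_, ?_, ?_, rfl⟩, fun n A a => ?_⟩
  · intro h
    have : (⟨fun _ => True, fun _ _ => True⟩ : AtomicType L m) ∈
        (Finset.univ : Finset (AtomicType L m)).toList := by simp
    rw [List.map_eq_nil_iff.1 h] at this
    exact List.not_mem_nil this
  · intro p hp χ hχ
    obtain ⟨q, _, rfl⟩ := List.mem_map.1 hp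
    exact AtomicType.isLiteral_of_mem_literals hχ
  · have himp : ∀ q : AtomicType L m, PLA.value A
        (.imp (PLA.listConj q.literals) (.const (f q))) a =
        if atomicType A a = q then f q else 1 := fun q => by
      rw [PLA.value, AtomicType.value_listConj_literals, PLA.value]
      have := (f q).2
      split_ifs
      · ext; simp [unitImp, this.2]
      · ext; simp [unitImp, this.1]
    have hc : ∀ c : unitInterval, c ≤ PLA.value A (PLA.listConj (((Finset.univ : Finset
        (AtomicType L m)).toList.map fun q => (q.literals, f q)).map
          fun q => .imp (PLA.listConj q.1) (.const q.2))) a ↔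
        ∀ q, c ≤ if atomicType A a = q then f q else 1 := fun c => by
      simp only [PLA.le_value_listConj, List.map_map, List.mem_map, Finset.mem_toList,
        Finset.mem_univ, true_and, forall_exists_index, forall_apply_eq_imp_iff,
        Function.comp_apply, himp]
    refine le_antisymm ?_ ((hc _).2 fun q => ?_)
    · simpa using (hc _).1 le_rfl (atomicType A a)
    · split_ifs with h
      · rw [h]
      · exact unitInterval.le_one'

variable [L.IsRelational] {G : PLANetwork L}

theorem eventually_card_bounds (K d : ℕ) {δ : ℝ} (hδ : 0 < δ) (N : ℕ) :
    ∀ᶠ n : ℕ in atTop, 0 < n ∧ 0 < (n - K) ^ d ∧ (d ≠ 0 → N ≤ (n - K) ^ d) ∧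
      (1 - δ) * (n : ℝ) ^ d ≤ ((n - K) ^ d : ℕ) := by
  have h1 : Tendsto (fun n : ℕ => (1 - (K : ℝ) / n) ^ d) atTop (𝓝 1) := by
    have := ((tendsto_const_div_atTop_nhds_zero_nat (K : ℝ)).const_sub 1).pow d
    simpa using this
  filter_upwards [h1.eventually_const_le (show 1 - δ < 1 by linarith),
    eventually_ge_atTop (K + N + 1)] with n hn hnK
  refine ⟨by omega, Nat.pow_pos (by omega), fun hd => ?_, ?_⟩
  · exact le_trans (by omega) (Nat.le_self_pow hd (n - K))
  · have hn0 : (0 : ℝ) < n := by exact_mod_cast (show 0 < n by omega)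
    have : (((n - K) ^ d : ℕ) : ℝ) = (1 - (K : ℝ) / n) ^ d * (n : ℝ) ^ d := by
      rw [← mul_pow, Nat.cast_pow, Nat.cast_sub (by omega)]
      congr 1
      field_simp
    rw [this]
    gcongr

/-- Aggregations of formulas that are determined up to a small error by atomic types are themselves
determined by atomic types. -/
theorem exists_atomicType_value_agg (hG : ∀ R, (G.θ R).AggFree) {m k p l : ℕ} (hk : 0 < k)
    {F : AggFun k} (hF : F.Admissible) (x : Fin p ↪ Fin m) (φ : Fin k → PLA L (p + l))
    (e : Setoid (Fin (p + l))) (f : Fin k → AtomicType L (p + l) → unitInterval)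
    (hf : ∀ i, ∀ ε : ℝ, 0 < ε → G.WHP fun n A => ∀ c : Fin (p + l) → Fin n,
      |((φ i).value A c : ℝ) - f i (atomicType A c)| ≤ ε) :
    ∃ y : AtomicType L m → unitInterval, ∀ ε : ℝ, 0 < ε → G.WHP fun n A => ∀ a : Fin m → Fin n,
      |((PLA.agg k hk p l F x φ e).value A a : ℝ) - y (atomicType A a)| ≤ ε := by
  obtain ⟨d, w, -, hpos, hcard, hlim⟩ := exists_append_weight (G := G) hG e
  have hfin : ∀ t : AtomicType L p, Fintype {q : AtomicType L (p + l) //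
      (q.2 = fun i j => e.r i j) ∧ q.comap (Fin.castAdd l) = t ∧ 0 < w q} :=
    fun t => Fintype.ofFinite _
  have hy : ∀ t : AtomicType L p, ∃ y : unitInterval, ∀ ε : ℝ, 0 < ε → ∃ δ : ℝ, 0 < δ ∧
      ∃ N : ℕ, ∀ (M : ℕ+) (R : Fin k → UnitSeq), (d = 0 → M = 1) → (d ≠ 0 → N ≤ M) →
        NearSampled (fun q : {q : AtomicType L (p + l) // (q.2 = fun i j => e.r i j) ∧
          q.comap (Fin.castAdd l) = t ∧ 0 < w q} => w q) (fun i q => f i q) δ M R →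
        |(F.toFun R : ℝ) - y| ≤ ε := by
    intro t
    -- If no new element is involved, the sequences have length `1` for every `n`, so admissibility
    -- on long sequences says nothing.
    by_cases hd : d = 0
    · obtain ⟨y, hy⟩ := hF.exists_limit_one (fun q : {q : AtomicType L (p + l) //
        (q.2 = fun i j => e.r i j) ∧ q.comap (Fin.castAdd l) = t ∧ 0 < w q} => w q)
        (fun i q => f i q)
      refine ⟨y, fun ε hε => ?_⟩
      obtain ⟨δ, hδ, h⟩ := hy ε hε
      refine ⟨δ, hδ, 0, fun M R hM _ hR => ?_⟩
      obtain rfl := hM hd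
      exact h R hR
    · obtain ⟨y, hy⟩ := hF.exists_limit (w := fun q : {q : AtomicType L (p + l) //
        (q.2 = fun i j => e.r i j) ∧ q.comap (Fin.castAdd l) = t ∧ 0 < w q} => w q)
        (fun q => q.2.2.2) (fun i q => f i q)
      refine ⟨y, fun ε hε => ?_⟩
      obtain ⟨δ, hδ, N, h⟩ := hy ε hε
      exact ⟨δ, hδ, N, fun M R _ hM hR => h M R (hM hd) hR⟩
  choose y hy using hy
  refine ⟨fun t => if (t.comap x).2 = (fun i j => (e.comap (Fin.castAdd l)).r i j) then
    y (t.comap x) else 0, fun ε hε => ?_⟩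
  have hall : ∀ t : AtomicType L p, G.WHP fun n A => ∀ a : Fin m → Fin n,
      atomicType A (a ∘ x) = t → |((PLA.agg k hk p l F x φ e).value A a : ℝ) -
        (if t.2 = (fun i j => (e.comap (Fin.castAdd l)).r i j) then y t else 0 : unitInterval)| ≤
        ε := by
    intro t
    by_cases ht : t.2 = fun i j => (e.comap (Fin.castAdd l)).r i j
    swap
    -- The type of the free variables contradicts `e`: nothing is listed and the value is `0` by
    -- convention.
    · refine PLANetwork.whp_of_eventually (Eventually.of_forall fun n A _ a ha => ?_)
      have hempty : IsEmpty (Realizations (a ∘ x) e) := ⟨fun ⟨b, hb⟩ => ht (by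
        rw [← ha]
        refine (matchesEq_iff (A := A)).1 ?_
        have := MatchesEq.comp (e := e) hb (Fin.castAdd l)
        have hab : Fin.append (a ∘ x) b ∘ Fin.castAdd l = a ∘ x := by ext; simp
        rwa [hab] at this)⟩
      rw [if_neg ht, PLA.value, dif_neg (by simp)]
      simpa using hε.le
    obtain ⟨δ, hδ, N, hN⟩ := hy t ε hε
    refine ((PLANetwork.WHP.forall fun i => hf i δ hδ).and (hlim (δ / 2) (by linarith))).mono ?_
    filter_upwards [eventually_card_bounds (p + l) d (half_pos hδ) N]
      with n ⟨hn, hlow, hlowN, hlowδ⟩ A hA ⟨hφ, hcount⟩ a ha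
    rw [if_pos ht]
    have hmatch : MatchesEq (e.comap (Fin.castAdd l)) (a ∘ x) :=
      (matchesEq_iff (A := A)).2 (ha ▸ ht)
    obtain ⟨hM₁, hM₂⟩ := hcard n (a ∘ x)
    specialize hM₂ hmatch
    have hMcard : Nat.card (Realizations (a ∘ x) e) = (Finset.univ.filter fun b : Fin l → Fin n =>
        MatchesEq e (Fin.append (a ∘ x) b)).card := by
      rw [Nat.card_eq_fintype_card, Fintype.card_subtype]
      refine congrArg _ (Finset.ext fun b => ?_)
      simp only [Finset.mem_filter, Finset.mem_univ, true_and]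
      rfl
    rw [← hMcard] at hM₁ hM₂
    have hM0 : 0 < Nat.card (Realizations (a ∘ x) e) := hlow.trans_le hM₂
    rw [PLA.value, dif_pos hM0]
    set M : ℕ+ := ⟨Nat.card (Realizations (a ∘ x) e), hM0⟩
    set E := Finite.equivFin (Realizations (a ∘ x) e)
    refine hN M _ (fun hd => ?_) (fun hd => (hlowN hd).trans hM₂) ?_
    · subst hd
      exact PNat.eq (le_antisymm (hM₁.trans_eq (pow_zero n)) hM0)
    -- Since `A` is not null, only labels of positive weight are sampled.
    have hq : ∀ b : Fin l → Fin n, MatchesEq e (Fin.append (a ∘ x) b) →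
        ((atomicType A (Fin.append (a ∘ x) b)).2 = fun i j => e.r i j) ∧
        (atomicType A (Fin.append (a ∘ x) b)).comap (Fin.castAdd l) = t ∧
        0 < w (atomicType A (Fin.append (a ∘ x) b)) := fun b hb => by
      refine ⟨matchesEq_iff.1 hb, ?_, hpos n A _ hA hb⟩
      rw [← ha, ← atomicType_comp]
      congr 1
      ext; simp
    refine ⟨_, fun j => ⟨atomicType A (Fin.append (a ∘ x) (E.symm j).1), hq _ (E.symm j).2⟩, rfl,
      fun i j => hφ i _, fun q => ?_⟩
    have hc := hcount (a ∘ x) q.1 q.2.1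
    rw [if_pos (ha.trans q.2.2.1.symm)] at hc
    have hcc : (Finset.univ.filter fun j : Fin M => (⟨atomicType A
        (Fin.append (a ∘ x) (E.symm j).1), hq _ (E.symm j).2⟩ : {q : AtomicType L (p + l) //
          (q.2 = fun i j => e.r i j) ∧ q.comap (Fin.castAdd l) = t ∧ 0 < w q}) = q).card =
        (Finset.univ.filter fun b : Fin l → Fin n =>
          atomicType A (Fin.append (a ∘ x) b) = q.1).card := by
      refine Finset.card_bij (fun j _ => (E.symm j).1) (fun j hj => ?_) (fun j _ j' _ h => ?_)
        fun b hb => ?_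
      · simp only [Finset.mem_filter, Finset.mem_univ, true_and] at hj ⊢
        exact congrArg Subtype.val hj
      · exact E.symm.injective (Subtype.ext h)
      · simp only [Finset.mem_filter, Finset.mem_univ, true_and] at hb ⊢
        have hb' : MatchesEq e (Fin.append (a ∘ x) b) := (matchesEq_iff (A := A)).2 (hb ▸ q.2.1)
        refine ⟨E ⟨b, hb'⟩, ?_, by simp⟩
        apply Subtype.ext
        simpa using hb
    have hcM := (Finset.card_le_univ (Finset.univ.filter fun j : Fin M => (⟨atomicType A
        (Fin.append (a ∘ x) (E.symm j).1), hq _ (E.symm j).2⟩ : {q : AtomicType L (p + l) //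
          (q.2 = fun i j => e.r i j) ∧ q.comap (Fin.castAdd l) = t ∧ 0 < w q}) = q))
    rw [Fintype.card_fin] at hcM
    rw [hcc] at hcM ⊢
    generalize (Finset.univ.filter fun b : Fin l → Fin n =>
          atomicType A (Fin.append (a ∘ x) b) = q.1).card = c at hc hcM ⊢
    have hMr : (0 : ℝ) < ((M : ℕ) : ℝ) := by exact_mod_cast hM0
    have hnr : (0 : ℝ) < (n : ℝ) ^ d := by positivity
    have h1 : ((M : ℕ) : ℝ) ≤ (n : ℝ) ^ d := by exact_mod_cast hM₁
    have h2 : (1 - δ / 2) * (n : ℝ) ^ d ≤ ((M : ℕ) : ℝ) := hlowδ.trans (by exact_mod_cast hM₂)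
    -- The counts are controlled relative to `n ^ d`, the frequencies relative to the true length
    -- `M`, which is at least `(1 - δ / 2) n ^ d`.
    have h3 : |(c : ℝ) / (M : ℕ) - c / (n : ℝ) ^ d| ≤ δ / 2 := by
      have : (c : ℝ) / (M : ℕ) - c / (n : ℝ) ^ d =
          (c / (M : ℕ)) * (((n : ℝ) ^ d - (M : ℕ)) / (n : ℝ) ^ d) := by
        field_simp
      rw [this, abs_of_nonneg (mul_nonneg (by positivity)
        (div_nonneg (by linarith) hnr.le))]
      have h4 : (c : ℝ) / (M : ℕ) ≤ 1 := div_le_one_of_le₀ (by exact_mod_cast hcM) hMr.le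
      refine (mul_le_of_le_one_left (div_nonneg (by linarith) hnr.le) h4).trans ?_
      rw [div_le_iff₀ hnr]
      linarith
    refine (abs_sub_le _ (c / (n : ℝ) ^ d) _).trans ?_
    linarith
  refine (PLANetwork.WHP.forall hall).mono (Eventually.of_forall fun n A _ h a => ?_)
  exact h _ a rfl

theorem PLA.exists_atomicType_value_of_eq {m : ℕ} {φ : PLA L m}
    (f : AtomicType L m → unitInterval)
    (h : ∀ (n : ℕ) (A : L.Structure (Fin n)) (a : Fin m → Fin n),
      φ.value A a = f (atomicType A a)) :
    ∃ f : AtomicType L m → unitInterval, ∀ ε : ℝ, 0 < ε → G.WHP fun n A => ∀ a : Fin m → Fin n,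
      |(φ.value A a : ℝ) - f (atomicType A a)| ≤ ε :=
  ⟨f, fun ε hε => PLANetwork.whp_of_eventually (Eventually.of_forall fun n A _ a => by
    rw [h, sub_self, abs_zero]; exact hε.le)⟩

/-- The truth functions of the connectives are Lipschitz, so uniform errors propagate through them;
aggregations are the only substantial case. -/
theorem PLA.exists_atomicType_value (hG : ∀ R, (G.θ R).AggFree) {m : ℕ} {φ : PLA L m}
    (hφ : φ.AllAdmissible) :
    ∃ f : AtomicType L m → unitInterval, ∀ ε : ℝ, 0 < ε → G.WHP fun n A => ∀ a : Fin m → Fin n,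
      |(φ.value A a : ℝ) - f (atomicType A a)| ≤ ε := by
  induction φ with
  | const c =>
    exact PLA.exists_atomicType_value_of_eq (fun _ => c) fun _ _ _ => by rw [PLA.value]
  | eq x y =>
    exact PLA.exists_atomicType_value_of_eq (fun q => if q.2 x y then 1 else 0)
      fun _ _ _ => by rw [PLA.value]; rfl
  | rel R x =>
    exact PLA.exists_atomicType_value_of_eq (fun q => if q.1 ⟨R, x⟩ then 1 else 0)
      fun _ _ _ => by rw [PLA.value]; rfl
  | neg φ ih =>
    obtain ⟨f, hf⟩ := ih hφ
    refine ⟨fun q => unitInterval.symm (f q), fun ε hε => (hf ε hε).mono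
      (Eventually.of_forall fun n A _ h a => ?_)⟩
    have := h a
    simp only [PLA.value, unitInterval.coe_symm_eq]
    rw [abs_le] at this ⊢
    constructor <;> linarith
  | conj φ ψ ih₁ ih₂ =>
    obtain ⟨f, hf⟩ := ih₁ hφ.1
    obtain ⟨g, hg⟩ := ih₂ hφ.2
    refine ⟨fun q => min (f q) (g q), fun ε hε => ((hf ε hε).and (hg ε hε)).mono
      (Eventually.of_forall fun n A _ h a => ?_)⟩
    have hcoe : Monotone ((↑) : unitInterval → ℝ) := fun _ _ h => h
    rw [PLA.value, hcoe.map_min, hcoe.map_min]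
    exact (abs_min_sub_min_le_max _ _ _ _).trans (max_le (h.1 a) (h.2 a))
  | disj φ ψ ih₁ ih₂ =>
    obtain ⟨f, hf⟩ := ih₁ hφ.1
    obtain ⟨g, hg⟩ := ih₂ hφ.2
    refine ⟨fun q => max (f q) (g q), fun ε hε => ((hf ε hε).and (hg ε hε)).mono
      (Eventually.of_forall fun n A _ h a => ?_)⟩
    have hcoe : Monotone ((↑) : unitInterval → ℝ) := fun _ _ h => h
    rw [PLA.value, hcoe.map_max, hcoe.map_max]
    exact (abs_max_sub_max_le_max _ _ _ _).trans (max_le (h.1 a) (h.2 a))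
  | imp φ ψ ih₁ ih₂ =>
    obtain ⟨f, hf⟩ := ih₁ hφ.1
    obtain ⟨g, hg⟩ := ih₂ hφ.2
    refine ⟨fun q => unitImp (f q) (g q), fun ε hε =>
      ((hf (ε / 2) (by linarith)).and (hg (ε / 2) (by linarith))).mono
      (Eventually.of_forall fun n A _ h a => ?_)⟩
    have h₁ := h.1 a
    have h₂ := h.2 a
    simp only [PLA.value, unitImp]
    refine (abs_min_sub_min_le_max _ _ _ _).trans (max_le (by simpa using hε.le) ?_)
    rw [abs_le] at h₁ h₂ ⊢
    constructor <;> linarith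
  | wmean φ ψ χ ih₁ ih₂ ih₃ =>
    obtain ⟨f, hf⟩ := ih₁ hφ.1
    obtain ⟨g, hg⟩ := ih₂ hφ.2.1
    obtain ⟨s, hs⟩ := ih₃ hφ.2.2
    refine ⟨fun q => unitMean (f q) (g q) (s q), fun ε hε =>
      ((hf (ε / 3) (by linarith)).and ((hg (ε / 3) (by linarith)).and
        (hs (ε / 3) (by linarith)))).mono (Eventually.of_forall fun n A _ h a => ?_)⟩
    have h₁ := h.1 a
    have h₂ := h.2.1 a
    have h₃ := h.2.2 a
    simp only [PLA.value, unitMean]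
    obtain ⟨b0, b1⟩ := (ψ.value A a).2
    obtain ⟨c0, c1⟩ := (χ.value A a).2
    obtain ⟨f0, f1⟩ := (f (atomicType A a)).2
    generalize (φ.value A a : ℝ) = x₁ at *
    generalize (ψ.value A a : ℝ) = x₂ at *
    generalize (χ.value A a : ℝ) = x₃ at *
    generalize (f (atomicType A a) : ℝ) = y₁ at *
    generalize (g (atomicType A a) : ℝ) = y₂ at *
    generalize (s (atomicType A a) : ℝ) = y₃ at *
    -- Each term is one of the three errors times a factor of absolute value at most `1`.
    have e : x₁ * x₂ + (1 - x₁) * x₃ - (y₁ * y₂ + (1 - y₁) * y₃) =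
        (x₁ - y₁) * (x₂ - x₃) + y₁ * (x₂ - y₂) + (1 - y₁) * (x₃ - y₃) := by ring
    rw [e]
    have t₁ : |(x₁ - y₁) * (x₂ - x₃)| ≤ ε / 3 := by
      rw [abs_mul]
      exact (mul_le_of_le_one_right (abs_nonneg _)
        (abs_le.2 ⟨by linarith, by linarith⟩)).trans h₁
    have t₂ : |y₁ * (x₂ - y₂)| ≤ ε / 3 := by
      rw [abs_mul, abs_of_nonneg f0]
      exact (mul_le_of_le_one_left (abs_nonneg _) f1).trans h₂
    have t₃ : |(1 - y₁) * (x₃ - y₃)| ≤ ε / 3 := by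
      rw [abs_mul, abs_of_nonneg (sub_nonneg.2 f1)]
      exact (mul_le_of_le_one_left (abs_nonneg _) (by linarith)).trans h₃
    refine (abs_add_three _ _ _).trans ?_
    linarith
  | agg k hk p l F x φ e ih =>
    choose f hf using fun i => ih i (hφ.2 i)
    exact exists_atomicType_value_agg hG hk hφ.1 x φ e f hf

end Elimination

end

theorem mainTheorem1 {L : FirstOrder.Language.{u, v}} [L.IsRelational] [Fintype (RelSymb L)]
    (G : PLANetwork L) (hG : ∀ R : RelSymb L, (G.θ R).AggFree)
    {m : ℕ} (φ : PLA L m) (hφ : φ.AllAdmissible) :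
    ∃ ψ : PLA L m, ψ.IsBasicProbability ∧ G.AsympEquiv φ ψ := by
  obtain ⟨f, hf⟩ := PLA.exists_atomicType_value (G := G) hG hφ
  obtain ⟨ψ, hψ, hval⟩ := exists_isBasicProbability_value f
  refine ⟨ψ, hψ, fun ε hε => ?_⟩
  have := hf ε hε
  simpa only [PLANetwork.WHP, hval, not_forall, not_le] using this
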